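/- Let $K\subset\mathbb{C}$ be a subfield and let $\eta\in\mathbb{C}$ satisfy $0<|\eta|<1$ and $[K(\eta):K]<\infty$. Let $u_1,\dots,u_m\in K$, let $p=(p_1,\dots,p_m)$ be a probability vector, and put $\nu=\sum_{j=1}^m p_j\delta_{u_j}$. Let $$h_{\eta,\nu}=\lim_{n\to\infty}\frac1n\,H\Big(\sum_{j=0}^{n-1}\xi_j\eta^j\Big)$$ be the Garsia entropy, where $\xi_0,\xi_1,\dots$ are independent random variables with common law $\nu$ and $H(X)=-\sum_x \mathbb{P}\{X=x\}\log\mathbb{P}\{X=x\}$ is the Shannon entropy of a discrete random variable $X$. For $a\in\mathbb{R}$ let $$\Phi_\nu(a)=\sup_{t>0}\big\{H(ta\xi+G)-H(t\xi+G)\big\},$$ where $\xi$ is a random variable with law $\nu$, $G$ is a complex Gaussian random variable independent of $\xi$ with density $\frac{1}{2\pi}e^{-|z|^2/2}$ on $\mathbb{C}$, and here $H(X)=-\int_{\mathbb{C}} f\log f$ is the differential entropy of a random variable $X$ with density $f$ with respect to Lebesgue measure on $\mathbb{C}=\mathbb{R}^2$. Let $$\widetilde M_K(\eta)=\prod_{\eta_j}\frac{1}{\min\{1,|\eta_j|\}},$$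 the product running over all the conjugates $\eta_j\in\mathbb{C}$ of $\eta$ over $K$, including $\eta$ itself. Then the limit defining $h_{\eta,\nu}$ exists, the random variables $c\xi+G$ $(c\in\mathbb{R})$ have densities and finite differential entropies, and $$h_{\eta,\nu}\ \ge\ \Phi_\nu\big(\widetilde M_K(\eta)\big).$$ -/

import Mathlib

open MeasureTheory Filter Topology

noncomputable section

/-- The Shannon entropy (natural logarithm) `∑ₓ - P{X = x} log P{X = x}` of a discrete complex
random variable `X` with law `μ`. Points which are not atoms contribute `0`. -/
def shannonEntropy (μ : Measure ℂ) : ℝ :=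
  ∑' x : ℂ, Real.negMulLog (μ.real {x})

/-- The Lebesgue density of an absolutely continuous measure on `ℂ = ℝ²`. -/
def lebesgueDensity (μ : Measure ℂ) (z : ℂ) : ℝ :=
  (μ.rnDeriv volume z).toReal

/-- The differential entropy `∫ - f log f` of an absolutely continuous complex random variable
with law `μ` and Lebesgue density `f`. -/
def differentialEntropy (μ : Measure ℂ) : ℝ :=
  ∫ z : ℂ, Real.negMulLog (lebesgueDensity μ z)

/-- The differential entropy of the law `μ` is well defined and finite: `μ` has a Lebesgue
density `f` and `f log f` is integrable. -/
def HasDifferentialEntropy (μ : Measure ℂ) : Prop :=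
  μ ≪ volume ∧ Integrable (fun z : ℂ => Real.negMulLog (lebesgueDensity μ z))

/-- The atomic measure `∑ⱼ pⱼ δ_{uⱼ}`. -/
def atomicMeasure {m : ℕ} (p : Fin m → ℝ) (u : Fin m → ℂ) : Measure ℂ :=
  ∑ j, ENNReal.ofReal (p j) • Measure.dirac (u j)

/-- The law of `∑_{j < n} ξⱼ ηʲ`, where `ξ₀, …, ξₙ₋₁` are independent with common law `ν`. -/
def garsiaLaw (η : ℂ) (ν : Measure ℂ) (n : ℕ) : Measure ℂ :=
  (Measure.pi (fun _ : Fin n => ν)).map (fun ξ => ∑ j : Fin n, ξ j * η ^ (j : ℕ))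

/-- The Garsia entropy `h_{η,ν} = lim_{n → ∞} H(∑_{j < n} ξⱼ ηʲ) / n`. -/
def garsiaEntropy (η : ℂ) (ν : Measure ℂ) : ℝ :=
  limUnder atTop (fun n : ℕ => shannonEntropy (garsiaLaw η ν n) / n)

/-- The standard Gaussian law on `ℂ`, with density `exp(-|z|²/2) / (2π)`. -/
def complexGaussian : Measure ℂ :=
  volume.withDensity
    (fun z : ℂ => ENNReal.ofReal (Real.exp (-‖z‖ ^ 2 / 2) / (2 * Real.pi)))

/-- The law of `c ξ + G`, where `ξ` has law `ν` and `G` is a standard complex Gaussian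
independent of `ξ`. -/
def smoothedLaw (ν : Measure ℂ) (c : ℝ) : Measure ℂ :=
  (ν.prod complexGaussian).map (fun q => (c : ℂ) * q.1 + q.2)

/-- `Φ_ν(a) = sup_{t > 0} (H(t a ξ + G) - H(t ξ + G))`. The supremum is taken in the extended
reals, so that it is a genuine supremum. -/
def gaussianGain (ν : Measure ℂ) (a : ℝ) : EReal :=
  ⨆ t : Set.Ioi (0 : ℝ),
    ((differentialEntropy (smoothedLaw ν ((t : ℝ) * a))
      - differentialEntropy (smoothedLaw ν (t : ℝ)) : ℝ) : EReal)

/-- `M̃_K(η) = ∏ 1 / min {1, |β|}`, the product over all conjugates `β` of `η` over `K`, that is,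
over the distinct complex roots of the minimal polynomial of `η` over `K`. -/
def mahlerTilde (K : Subfield ℂ) (η : ℂ) : ℝ :=
  ∏ β ∈ ((minpoly K η).rootSet ℂ).toFinset, 1 / min 1 ‖β‖

end

/-!
The Garsia entropy is bounded below by the increments of a conditional entropy along a linear
system whose eigenvalues are the conjugates of `η` inside the unit disc.

Let `s` be the set of these conjugates and let `D` be a number with `|D| = ∏_{β ∈ s} |β|`, so that
`mahlerTilde K η = 1 / |D|`. A cascade of plane rotations (`exists_unitary_blocks`) gives a unitary
matrix `[A, v; w, D]` such that `A` has the characteristic polynomial `∏_{β ∈ s} (X - β)`. Unitarity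
says that `A Aᴴ + v vᴴ = 1`, that `v` and `w` have norm `√(1 - |D|²)`, and that `A wᴴ = - D̄ v`, so
that `A⁻¹ v` has the norm of `v` divided by `|D|`.

For a word `a = (a₀, …, aₙ₋₁)` of independent letters put `x(a) = τ ∑ⱼ u(aⱼ) Aʲ v`, and let `G` be a
standard Gaussian vector independent of `a`. Consider `Cₖ = H(a | A⁻ᵏ x(a) + G)`.
* `C₀ ≤ H(a)`, since conditioning decreases entropy (`condEntropy_le_sum_negMulLog`).
* `Cₙ ≥ H(a) - H(∑ⱼ u(aⱼ) ηʲ)`. By the Cayley-Hamilton theorem, the sum `∑ⱼ u(aⱼ) ηʲ` determines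
  `x(a)`, since the letters `u` lie in `K` and the eigenvalues of `A` are conjugates of `η`
  (`wordPoint_eq_of_sum_eq`, `sum_negMulLog_sub_atomicEntropy_le_condEntropy`).
* `Cₖ - Cₖ₊₁ ≥ H(ξ | τ ξ v + G) - H(ξ | τ ξ A⁻¹ v + G)`. By the chain rule, `Cₖ` is the sum of the
  conditional entropy of the letters other than the one with number `k` and of the conditional
  entropy of that letter given the others. The second part contributes the difference on the right.
  The first part is at least as large for `k` as for `k + 1`: as `A G + v g`, with an independent
  `g`, has the law of `G`, the observation for `k` is obtained from that for `k + 1` by applying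
  `A` and adding the noise `v g` (`condEntropy_wordPoint_step`).

Summing over `k` gives `H(∑ⱼ u(aⱼ) ηʲ) ≥ n (H(ξ | τ ξ v + G) - H(ξ | τ ξ A⁻¹ v + G))`. By rotation
invariance (`condEntropy_gaussianTranslates_smul`) the two terms are one-dimensional, and for a
suitable `τ` they are `H(ξ | t ξ + G)` and `H(ξ | t ξ / |D| + G)`; their difference is the
difference of the differential entropies of `t ξ / |D| + G` and `t ξ + G`. The limit which defines
the Garsia entropy exists by subadditivity.
-/

noncomputable section

/-! ### Conditional entropy of a finite variable -/

section Entropy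

open InformationTheory

variable {κ ι E F E' : Type*} [MeasurableSpace E] [MeasurableSpace F] [MeasurableSpace E']

/-- The entropy `∫ - f log f dρ` of a measure `μ` with density `f` with respect to `ρ`. For
`ρ` the Lebesgue measure this is the differential entropy. -/
def densityEntropy (μ ρ : Measure E) : ℝ :=
  ∫ x, Real.negMulLog ((μ.rnDeriv ρ x).toReal) ∂ρ

/-- The conditional entropy `H(ξ | Y)` of a variable `ξ` with values in the finite type `κ` given
a variable `Y` with values in `E`. The joint law is encoded by the measures
`m i = P(ξ = i, Y ∈ ·)`, so that `∑ j, m j` is the law of `Y` and the density of `m i` with respect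
to it is the posterior probability of `ξ = i`. -/
def condEntropy [Fintype κ] (m : κ → Measure E) : ℝ :=
  ∑ i, densityEntropy (m i) (∑ j, m j)

lemma densityEntropy_zero_left (ρ : Measure E) : densityEntropy 0 ρ = 0 := by
  refine integral_eq_zero_of_ae ?_
  filter_upwards [Measure.rnDeriv_zero ρ] with x hx
  simp [hx]

lemma le_sum_measure [Fintype κ] (m : κ → Measure E) (i : κ) : m i ≤ ∑ j, m j := by
  classical
  exact Finset.single_le_sum (f := m) (fun _ _ => Measure.zero_le _) (Finset.mem_univ i)

lemma integrable_negMulLog_rnDeriv_of_le {μ ρ : Measure E} [IsFiniteMeasure ρ] (h : μ ≤ ρ) :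
    Integrable (fun x => Real.negMulLog ((μ.rnDeriv ρ x).toReal)) ρ := by
  refine Integrable.mono' (integrable_const (1 : ℝ)) ?_ ?_
  · exact (Real.continuous_negMulLog.measurable.comp
      (Measure.measurable_rnDeriv _ _).ennreal_toReal).aestronglyMeasurable
  · filter_upwards [Measure.rnDeriv_le_one_of_le h] with x hx
    have h0 : 0 ≤ (μ.rnDeriv ρ x).toReal := ENNReal.toReal_nonneg
    have h1 : (μ.rnDeriv ρ x).toReal ≤ 1 :=
      ENNReal.toReal_le_of_le_ofReal zero_le_one (by simpa using hx)
    rw [Real.norm_of_nonneg (Real.negMulLog_nonneg h0 h1)]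
    linarith [Real.negMulLog_le_one_sub_self h0]

lemma klFun_eq_sub_negMulLog (x : ℝ) : klFun x = (1 - x) - Real.negMulLog x := by
  simp only [klFun_apply, Real.negMulLog]
  ring

lemma densityEntropy_eq_sub_klDiv {μ ρ : Measure E} [IsFiniteMeasure μ] [IsFiniteMeasure ρ]
    (h : μ ≤ ρ) :
    densityEntropy μ ρ = ρ.real Set.univ - μ.real Set.univ - (klDiv μ ρ).toReal := by
  have hac : μ ≪ ρ := Measure.absolutelyContinuous_of_le h
  rw [toReal_klDiv_eq_integral_klFun hac]
  simp_rw [klFun_eq_sub_negMulLog]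
  have hi : Integrable (fun x => 1 - (μ.rnDeriv ρ x).toReal) ρ :=
    (integrable_const _).sub Measure.integrable_toReal_rnDeriv
  rw [integral_sub hi (integrable_negMulLog_rnDeriv_of_le h), integral_sub (integrable_const _)
    Measure.integrable_toReal_rnDeriv, Measure.integral_toReal_rnDeriv hac]
  simp [densityEntropy]

lemma klDiv_ne_top_of_le {μ ρ : Measure E} [IsFiniteMeasure μ] [IsFiniteMeasure ρ]
    (h : μ ≤ ρ) : klDiv μ ρ ≠ ⊤ := by
  have hac : μ ≪ ρ := Measure.absolutelyContinuous_of_le h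
  refine klDiv_ne_top hac ?_
  rw [← integrable_klFun_rnDeriv_iff hac]
  simp_rw [klFun_eq_sub_negMulLog]
  exact ((integrable_const _).sub Measure.integrable_toReal_rnDeriv).sub
    (integrable_negMulLog_rnDeriv_of_le h)

lemma densityEntropy_le_map_prod {μ ρ : Measure E} [IsFiniteMeasure μ] [IsFiniteMeasure ρ]
    (h : μ ≤ ρ) (ν : Measure F) [IsProbabilityMeasure ν] {g : E × F → E'} (hg : Measurable g) :
    densityEntropy μ ρ ≤ densityEntropy ((μ.prod ν).map g) ((ρ.prod ν).map g) := by
  have h' : (μ.prod ν).map g ≤ (ρ.prod ν).map g :=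
    Measure.map_mono (Measure.prod_mono h le_rfl) hg
  rw [densityEntropy_eq_sub_klDiv h, densityEntropy_eq_sub_klDiv h']
  have e1 : ∀ (τ : Measure E) [IsFiniteMeasure τ],
      ((τ.prod ν).map g).real Set.univ = τ.real Set.univ := by
    intro τ _
    rw [measureReal_def, Measure.map_apply hg MeasurableSet.univ]
    simp [measureReal_def, Measure.prod_apply]
  rw [e1, e1]
  have e2 : klDiv ((μ.prod ν).map g) ((ρ.prod ν).map g) ≤ klDiv μ ρ := by
    refine (klDiv_map_le _ _ hg).trans ?_
    rw [← Measure.compProd_const, ← Measure.compProd_const, klDiv_compProd_left]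
  have := ENNReal.toReal_mono (klDiv_ne_top_of_le h) e2
  linarith

/-- Data processing inequality: passing from `Y` to `g (Y, Z)`, with `Z` independent of `(ξ, Y)`,
does not decrease the conditional entropy of `ξ`. -/
lemma condEntropy_le_map_prod [Fintype κ] (m : κ → Measure E) [∀ i, IsFiniteMeasure (m i)]
    (ν : Measure F) [IsProbabilityMeasure ν] {g : E × F → E'} (hg : Measurable g) :
    condEntropy m ≤ condEntropy (fun i => ((m i).prod ν).map g) := by
  unfold condEntropy
  refine Finset.sum_le_sum fun i _ => ?_
  have : ∑ j, ((m j).prod ν).map g = ((∑ j, m j).prod ν).map g := by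
    rw [← Measure.sum_fintype, ← Measure.sum_fintype, Measure.prod_sum_left,
      Measure.map_sum hg.aemeasurable]
  rw [this]
  exact densityEntropy_le_map_prod (le_sum_measure m i) ν hg

lemma condEntropy_le_map [Fintype κ] (m : κ → Measure E) [∀ i, IsFiniteMeasure (m i)]
    {g : E → E'} (hg : Measurable g) : condEntropy m ≤ condEntropy (fun i => (m i).map g) := by
  refine (condEntropy_le_map_prod m (Measure.dirac ()) (hg.comp measurable_fst)).trans_eq ?_
  congr 1
  ext1 i
  rw [← Measure.map_map hg measurable_fst, Measure.map_fst_prod]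
  simp

lemma rnDeriv_sum_ae [Fintype κ] (m : κ → Measure E) [∀ i, IsFiniteMeasure (m i)]
    (ρ : Measure E) [SigmaFinite ρ] :
    (∑ i, m i).rnDeriv ρ =ᵐ[ρ] fun x => ∑ i, (m i).rnDeriv ρ x := by
  classical
  have : ∀ s : Finset κ, (∑ i ∈ s, m i).rnDeriv ρ =ᵐ[ρ] fun x => ∑ i ∈ s, (m i).rnDeriv ρ x := by
    intro s
    induction s using Finset.induction_on with
    | empty =>
      simp only [Finset.sum_empty]
      exact Measure.rnDeriv_zero ρ
    | insert a s ha ih =>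
      rw [Finset.sum_insert ha]
      filter_upwards [Measure.rnDeriv_add' (m a) (∑ i ∈ s, m i) ρ, ih] with x h1 h2
      rw [h1, Pi.add_apply, h2, Finset.sum_insert ha]
  exact this _

/-- Pointwise form of the chain rule for entropy. -/
lemma sum_negMulLog_rnDeriv_ae [Fintype κ] (m : κ → Measure E) [∀ i, IsFiniteMeasure (m i)]
    (ρ : Measure E) [SigmaFinite ρ] :
    (fun x => ∑ i, Real.negMulLog (((m i).rnDeriv ρ x).toReal)) =ᵐ[ρ]
      fun x => Real.negMulLog (((∑ i, m i).rnDeriv ρ x).toReal) +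
        ∑ i, ((∑ i, m i).rnDeriv ρ x).toReal *
          Real.negMulLog (((m i).rnDeriv (∑ i, m i) x).toReal) := by
  set M := ∑ i, m i with hM
  have : IsFiniteMeasure M := by rw [hM]; infer_instance
  have h1 : ∀ᵐ x ∂ρ, ∀ i, (m i).rnDeriv M x * M.rnDeriv ρ x = (m i).rnDeriv ρ x := by
    rw [ae_all_iff]
    intro i
    exact Measure.rnDeriv_mul_rnDeriv (κ := ρ)
      (Measure.absolutelyContinuous_of_le (le_sum_measure m i))
  have h2 : ∀ᵐ x ∂ρ, M.rnDeriv ρ x ≠ 0 → ∑ i, ((m i).rnDeriv M x).toReal = 1 := by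
    refine Measure.ae_rnDeriv_ne_zero_imp_of_ae (μ := M) (ν := ρ)
      (p := fun x => ∑ i, ((m i).rnDeriv M x).toReal = 1) ?_
    have h3 : ∀ᵐ x ∂M, ∀ i, (m i).rnDeriv M x ≠ ⊤ := by
      rw [ae_all_iff]; exact fun i => Measure.rnDeriv_ne_top (m i) M
    filter_upwards [Measure.rnDeriv_self M, rnDeriv_sum_ae m M, h3] with x hx hx' hx3
    rw [← ENNReal.toReal_sum (fun i _ => hx3 i), ← hx', hx]
    simp
  filter_upwards [h1, h2] with x h1 h2
  have e : ∀ i, ((m i).rnDeriv ρ x).toReal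
      = ((m i).rnDeriv M x).toReal * (M.rnDeriv ρ x).toReal := fun i => by
    rw [← h1 i, ENNReal.toReal_mul]
  simp_rw [e, Real.negMulLog_mul]
  rw [Finset.sum_add_distrib, ← Finset.sum_mul, add_comm]
  by_cases h0 : M.rnDeriv ρ x = 0
  · simp [h0]
  · rw [h2 h0, one_mul]

lemma integrable_rnDeriv_mul_negMulLog [Fintype κ] (m : κ → Measure E)
    [∀ i, IsFiniteMeasure (m i)] (ρ : Measure E) [SigmaFinite ρ] (h : ∑ i, m i ≪ ρ) (i : κ) :
    Integrable (fun x => ((∑ i, m i).rnDeriv ρ x).toReal *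
          Real.negMulLog (((m i).rnDeriv (∑ i, m i) x).toReal)) ρ :=
  (integrable_toReal_rnDeriv_mul_iff h).2
    (integrable_negMulLog_rnDeriv_of_le (le_sum_measure m i))

lemma integrable_negMulLog_rnDeriv_sum [Fintype κ] (m : κ → Measure E)
    [∀ i, IsFiniteMeasure (m i)] (ρ : Measure E) [SigmaFinite ρ] (h : ∑ i, m i ≪ ρ)
    (hint : ∀ i, Integrable (fun x => Real.negMulLog (((m i).rnDeriv ρ x).toReal)) ρ) :
    Integrable (fun x => Real.negMulLog (((∑ i, m i).rnDeriv ρ x).toReal)) ρ := by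
  have h1 : Integrable (fun x => ∑ i, Real.negMulLog (((m i).rnDeriv ρ x).toReal)) ρ :=
    integrable_finsetSum _ fun i _ => hint i
  have h2 := integrable_finsetSum Finset.univ
    fun i _ => integrable_rnDeriv_mul_negMulLog m ρ h i
  refine (h1.sub h2).congr ?_
  filter_upwards [sum_negMulLog_rnDeriv_ae m ρ] with x hx
  simp only [Pi.sub_apply]
  rw [hx]; ring

/-- The chain rule `h(ξ, Y) = h(Y) + H(ξ | Y)`. -/
lemma sum_densityEntropy_eq_add_condEntropy [Fintype κ] (m : κ → Measure E)
    [∀ i, IsFiniteMeasure (m i)] (ρ : Measure E) [SigmaFinite ρ] (h : ∑ i, m i ≪ ρ)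
    (hint : ∀ i, Integrable (fun x => Real.negMulLog (((m i).rnDeriv ρ x).toReal)) ρ) :
    ∑ i, densityEntropy (m i) ρ = densityEntropy (∑ i, m i) ρ + condEntropy m := by
  unfold condEntropy densityEntropy
  rw [← integral_finsetSum _ fun i _ => hint i, integral_congr_ae (sum_negMulLog_rnDeriv_ae m ρ),
    integral_add (integrable_negMulLog_rnDeriv_sum m ρ h hint)
      (integrable_finsetSum _ fun i _ => integrable_rnDeriv_mul_negMulLog m ρ h i),
    integral_finsetSum _ fun i _ => integrable_rnDeriv_mul_negMulLog m ρ h i]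
  congr 1
  refine Finset.sum_congr rfl fun i _ => ?_
  rw [integral_toReal_rnDeriv_mul h]

/-- The chain rule `H(ξ, ζ | Y) = H(ζ | Y) + H(ξ | Y, ζ)`. -/
lemma condEntropy_prod [Fintype κ] [Fintype ι] (m : κ × ι → Measure E)
    [∀ i, IsFiniteMeasure (m i)] :
    condEntropy m = condEntropy (fun j => ∑ i, m (i, j)) + ∑ j, condEntropy fun i => m (i, j) := by
  have hM : ∑ j, ∑ i, m (i, j) = ∑ a, m a := by
    rw [Fintype.sum_prod_type_right]
  unfold condEntropy
  rw [Fintype.sum_prod_type_right, hM, ← Finset.sum_add_distrib]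
  refine Finset.sum_congr rfl fun j _ => ?_
  refine sum_densityEntropy_eq_add_condEntropy (fun i => m (i, j)) (∑ a, m a) ?_ ?_
  · rw [← hM]
    exact Measure.absolutelyContinuous_of_le (le_sum_measure (fun j => ∑ i, m (i, j)) j)
  · exact fun i => integrable_negMulLog_rnDeriv_of_le (le_sum_measure m (i, j))

lemma condEntropy_comp_equiv [Fintype κ] [Fintype ι] (e : ι ≃ κ) (m : κ → Measure E) :
    condEntropy (fun i => m (e i)) = condEntropy m := by
  unfold condEntropy
  rw [Equiv.sum_comp e m, Equiv.sum_comp e (fun i => densityEntropy (m i) (∑ j, m j))]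

lemma condEntropy_smul [Fintype κ] (m : κ → Measure E) [∀ i, IsFiniteMeasure (m i)]
    {c : ENNReal} (hc : c ≠ ⊤) :
    condEntropy (fun i => c • m i) = c.toReal * condEntropy m := by
  lift c to NNReal using hc
  unfold condEntropy
  rw [Finset.mul_sum]
  refine Finset.sum_congr rfl fun i _ => ?_
  rw [← Finset.smul_sum]
  have h := le_sum_measure m i
  have h' : c • m i ≤ c • ∑ j, m j := by gcongr
  change densityEntropy (c • m i) (c • ∑ j, m j) = _
  rw [densityEntropy_eq_sub_klDiv h, densityEntropy_eq_sub_klDiv h', klDiv_smul_same,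
    measureReal_nnreal_smul_apply, measureReal_nnreal_smul_apply, ENNReal.toReal_mul]
  simp only [ENNReal.coe_toReal]
  ring

/-- Conditioning decreases entropy. -/
lemma condEntropy_le_sum_negMulLog [Fintype κ] (m : κ → Measure E) [∀ i, IsFiniteMeasure (m i)]
    (h1 : ∑ i, (m i).real Set.univ = 1) :
    condEntropy m ≤ ∑ i, Real.negMulLog ((m i).real Set.univ) := by
  have hM : (∑ i, m i).real Set.univ = 1 := by
    rw [← h1, measureReal_def, Measure.coe_finsetSum, Finset.sum_apply,
      ENNReal.toReal_sum fun i _ => measure_ne_top _ _]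
    rfl
  refine Finset.sum_le_sum fun i _ => ?_
  have h := le_sum_measure m i
  have hac := Measure.absolutelyContinuous_of_le h
  rw [densityEntropy_eq_sub_klDiv h]
  have := mul_log_le_toReal_klDiv hac (klDiv_ne_top_iff.1 (klDiv_ne_top_of_le h)).2
  rw [hM] at this ⊢
  simp only [Real.negMulLog, div_one] at this ⊢
  linarith

/-- If the posterior probability of `ξ = i` is at most `c`, then the contribution of `i` to the
conditional entropy is at least `P(ξ = i) log (1 / c)`. -/
lemma mul_neg_log_le_densityEntropy {μ ρ : Measure E} [IsFiniteMeasure μ] [IsFiniteMeasure ρ]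
    (h : μ ≤ ρ) {c : ℝ} (hc : μ ≤ ENNReal.ofReal c • ρ) :
    μ.real Set.univ * -Real.log c ≤ densityEntropy μ ρ := by
  have hac := Measure.absolutelyContinuous_of_le h
  rw [← Measure.integral_toReal_rnDeriv hac, ← integral_mul_const]
  refine integral_mono_ae (Measure.integrable_toReal_rnDeriv.mul_const _)
    (integrable_negMulLog_rnDeriv_of_le h) ?_
  have hle : μ.rnDeriv ρ ≤ᵐ[ρ] fun _ => ENNReal.ofReal c := by
    refine ae_le_of_forall_setLIntegral_le_of_sigmaFinite (Measure.measurable_rnDeriv μ ρ)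
      fun s _ _ => ?_
    rw [setLIntegral_const]
    exact (Measure.setLIntegral_rnDeriv_le s).trans (by simpa using hc s)
  filter_upwards [hle] with x hx
  rcases (ENNReal.toReal_nonneg (a := μ.rnDeriv ρ x)).eq_or_lt with h0 | h0
  · simp [← h0]
  · have hx' : (μ.rnDeriv ρ x).toReal ≤ c := by
      have : 0 < c := by
        by_contra hneg
        rw [ENNReal.ofReal_of_nonpos (not_lt.1 hneg)] at hx
        rw [le_zero_iff.1 hx] at h0
        simp at h0
      exact ENNReal.toReal_le_of_le_ofReal this.le hx
    have := Real.log_le_log h0 hx'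
    simp only [Real.negMulLog]
    nlinarith

end Entropy

/-! ### Gaussian noise on complex vector spaces -/

section Gaussian

open Matrix

variable {κ ι σ τ : Type*} [Fintype ι] [Fintype σ] [Fintype τ]

lemma integral_gaussianDensity :
    ∫ z : ℂ, Real.exp (-‖z‖ ^ 2 / 2) / (2 * Real.pi) = 1 := by
  have h := GaussianFourier.integral_rexp_neg_mul_sq_norm (V := ℂ) (b := 1 / 2) (by norm_num)
  rw [integral_div]
  have e : ∀ z : ℂ, -‖z‖ ^ 2 / 2 = -(1 / 2) * ‖z‖ ^ 2 := fun z => by ring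
  simp_rw [e, h]
  rw [Complex.finrank_real_complex]
  norm_num
  field_simp

lemma integrable_gaussianDensity :
    Integrable (fun z : ℂ => Real.exp (-‖z‖ ^ 2 / 2) / (2 * Real.pi)) :=
  Integrable.of_integral_ne_zero (by rw [integral_gaussianDensity]; exact one_ne_zero)

instance isProbabilityMeasure_complexGaussian : IsProbabilityMeasure complexGaussian := by
  refine ⟨?_⟩
  rw [complexGaussian, withDensity_apply _ MeasurableSet.univ, Measure.restrict_univ,
    ← ofReal_integral_eq_lintegral_ofReal integrable_gaussianDensity
      (ae_of_all _ fun z => by positivity), integral_gaussianDensity, ENNReal.ofReal_one]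

lemma integral_cexp_complexGaussian (c : ℂ) :
    ∫ z, Complex.exp (((c * z).re : ℂ) * Complex.I) ∂complexGaussian
      = Complex.exp (-((‖c‖ ^ 2 / 2 : ℝ) : ℂ)) := by
  rw [complexGaussian, integral_withDensity_eq_integral_toReal_smul (by fun_prop)
    (ae_of_all _ fun _ => ENNReal.ofReal_lt_top)]
  have h := GaussianFourier.integral_cexp_neg_mul_sq_norm_add (V := ℂ) (b := 1 / 2) (by norm_num)
    Complex.I (starRingEnd ℂ c)
  have e : ∀ z : ℂ, (ENNReal.ofReal (Real.exp (-‖z‖ ^ 2 / 2) / (2 * Real.pi))).toReal •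
      Complex.exp (((c * z).re : ℂ) * Complex.I) = (1 / (2 * Real.pi) : ℂ) *
      Complex.exp (-(1 / 2) * (‖z‖ : ℂ) ^ 2 + Complex.I * (inner ℝ (starRingEnd ℂ c) z : ℝ)) := by
    intro z
    rw [ENNReal.toReal_ofReal (by positivity), Complex.inner, Complex.conj_conj, Complex.exp_add,
      Complex.real_smul]
    push_cast
    rw [mul_comm (((c * z).re : ℂ)) Complex.I]
    ring_nf
  simp_rw [e]
  rw [integral_const_mul, h, Complex.finrank_real_complex]
  have hpi : (Real.pi : ℂ) ≠ 0 := by exact_mod_cast Real.pi_ne_zero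
  norm_num
  field_simp

/-- The law of a family of independent standard complex Gaussian variables. -/
def gaussianPi (ι : Type*) [Fintype ι] : Measure (ι → ℂ) :=
  Measure.pi fun _ => complexGaussian

instance isProbabilityMeasure_gaussianPi : IsProbabilityMeasure (gaussianPi ι) := by
  unfold gaussianPi; infer_instance

lemma integral_cexp_gaussianPi (c : ι → ℂ) :
    ∫ x, Complex.exp (((c ⬝ᵥ x).re : ℂ) * Complex.I) ∂(gaussianPi ι)
      = Complex.exp (-((∑ i, ‖c i‖ ^ 2) / 2 : ℝ)) := by
  have e : ∀ x : ι → ℂ, Complex.exp (((c ⬝ᵥ x).re : ℂ) * Complex.I)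
      = ∏ i, Complex.exp (((c i * x i).re : ℂ) * Complex.I) := by
    intro x
    rw [← Complex.exp_sum, dotProduct, Complex.re_sum, Complex.ofReal_sum, Finset.sum_mul]
  simp_rw [e]
  rw [gaussianPi, integral_fintype_prod_eq_prod
    (f := fun i z => Complex.exp (((c i * z).re : ℂ) * Complex.I))]
  simp_rw [integral_cexp_complexGaussian]
  rw [← Complex.exp_sum]
  congr 1
  push_cast
  rw [Finset.sum_neg_distrib, Finset.sum_div]

lemma exists_strongDual_eq_re_dotProduct (L : StrongDual ℝ (ι → ℂ)) :
    ∃ c : ι → ℂ, ∀ x, L x = (c ⬝ᵥ x).re := by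
  classical
  refine ⟨fun i => ⟨L (Pi.single i 1), -L (Pi.single i Complex.I)⟩, fun x => ?_⟩
  have hx : x = ∑ i, ((x i).re • Pi.single (M := fun _ => ℂ) i (1 : ℂ)
      + (x i).im • Pi.single (M := fun _ => ℂ) i Complex.I) := by
    ext j
    simp only [Finset.sum_apply, Pi.add_apply, Pi.smul_apply, Pi.single_apply]
    rw [Finset.sum_eq_single j]
    · simp [Complex.re_add_im]
    · intro b _ hb
      simp [Ne.symm hb]
    · simp
  conv_lhs => rw [hx]
  rw [map_sum, dotProduct, Complex.re_sum]
  refine Finset.sum_congr rfl fun i _ => ?_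
  rw [map_add, map_smul, map_smul, Complex.mul_re]
  simp only [smul_eq_mul]
  ring

lemma sum_norm_sq_vecMul (B : Matrix τ ι ℂ) (c : τ → ℂ) :
    ((∑ i, ‖(c ᵥ* B) i‖ ^ 2 : ℝ) : ℂ) = c ⬝ᵥ ((B * Bᴴ) *ᵥ star c) := by
  rw [← mulVec_mulVec, dotProduct_mulVec, ← star_vecMul, dotProduct]
  push_cast
  refine Finset.sum_congr rfl fun i _ => ?_
  rw [Pi.star_apply, Complex.star_def, Complex.mul_conj, Complex.normSq_eq_norm_sq]
  push_cast
  rfl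

/-- A standard Gaussian vector is mapped to a standard Gaussian vector as soon as the covariance
matrices agree. -/
lemma map_gaussianPi_prod [DecidableEq τ] {B : Matrix τ ι ℂ} {C : Matrix τ σ ℂ}
    (h : B * Bᴴ + C * Cᴴ = 1) :
    ((gaussianPi ι).prod (gaussianPi σ)).map (fun q => B *ᵥ q.1 + C *ᵥ q.2) = gaussianPi τ := by
  have hm : Measurable fun q : (ι → ℂ) × (σ → ℂ) => B *ᵥ q.1 + C *ᵥ q.2 := by
    refine Continuous.measurable ?_
    fun_prop
  have : IsProbabilityMeasure (((gaussianPi ι).prod (gaussianPi σ)).map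
    fun q => B *ᵥ q.1 + C *ᵥ q.2) := Measure.isProbabilityMeasure_map hm.aemeasurable
  refine Measure.ext_of_charFunDual ?_
  ext L
  obtain ⟨c, hc⟩ := exists_strongDual_eq_re_dotProduct L
  rw [charFunDual_apply, charFunDual_apply, integral_map hm.aemeasurable (by fun_prop)]
  simp_rw [hc, dotProduct_add, dotProduct_mulVec, Complex.add_re, Complex.ofReal_add, add_mul,
    Complex.exp_add]
  rw [integral_prod_mul (fun x => Complex.exp ((((c ᵥ* B) ⬝ᵥ x).re : ℂ) * Complex.I))
    (fun y => Complex.exp ((((c ᵥ* C) ⬝ᵥ y).re : ℂ) * Complex.I)), integral_cexp_gaussianPi,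
    integral_cexp_gaussianPi, integral_cexp_gaussianPi, ← Complex.exp_add]
  congr 1
  have h1 : ((∑ i, ‖(c ᵥ* B) i‖ ^ 2 : ℝ) : ℂ) + ((∑ i, ‖(c ᵥ* C) i‖ ^ 2 : ℝ) : ℂ)
      = ((∑ i, ‖c i‖ ^ 2 : ℝ) : ℂ) := by
    rw [sum_norm_sq_vecMul, sum_norm_sq_vecMul, ← dotProduct_add, ← add_mulVec, h]
    have := sum_norm_sq_vecMul (1 : Matrix τ τ ℂ) c
    rw [vecMul_one] at this
    rw [this]
    simp
  push_cast at h1 ⊢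
  rw [← h1]
  ring

/-- The joint law of an index `k`, chosen with the weights `w`, and the point `x k + G`, where
`G` is a standard Gaussian vector independent of `k`. -/
def gaussianTranslates (w : κ → ENNReal) (x : κ → ι → ℂ) (k : κ) : Measure (ι → ℂ) :=
  w k • (gaussianPi ι).map fun y => x k + y

lemma isFiniteMeasure_gaussianTranslates {w : κ → ENNReal} (hw : ∀ k, w k ≠ ⊤) (x : κ → ι → ℂ)
    (k : κ) : IsFiniteMeasure (gaussianTranslates w x k) := by
  have : IsProbabilityMeasure ((gaussianPi ι).map fun y => x k + y) :=
    Measure.isProbabilityMeasure_map (by fun_prop)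
  exact Measure.smul_finite _ (hw k)

lemma map_gaussianTranslates_prod [DecidableEq τ] {B : Matrix τ ι ℂ} {C : Matrix τ σ ℂ}
    (h : B * Bᴴ + C * Cᴴ = 1) (w : κ → ENNReal) (x : κ → ι → ℂ) (z : τ → ℂ) (k : κ) :
    ((gaussianTranslates w x k).prod (gaussianPi σ)).map (fun q => z + (B *ᵥ q.1 + C *ᵥ q.2))
      = gaussianTranslates w (fun k => z + B *ᵥ x k) k := by
  have hm : Measurable fun q : (ι → ℂ) × (σ → ℂ) => B *ᵥ q.1 + C *ᵥ q.2 :=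
    Continuous.measurable (by fun_prop)
  have e : (Measure.map (fun y => x k + y) (gaussianPi ι)).prod (gaussianPi σ)
      = ((gaussianPi ι).prod (gaussianPi σ)).map (Prod.map (fun y => x k + y) id) := by
    rw [← Measure.map_prod_map _ _ (by fun_prop) measurable_id, Measure.map_id]
  unfold gaussianTranslates
  rw [Measure.prod_smul_left, Measure.map_smul, e, Measure.map_map (by fun_prop) (by fun_prop),
    ← map_gaussianPi_prod h, Measure.map_map (by fun_prop) hm]
  congr 2
  ext q : 1
  simp [mulVec_add, add_assoc]

/-- Contracting the points by `B` and adding an independent Gaussian vector which restores the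
covariance of the noise increases the uncertainty about the index. -/
lemma condEntropy_gaussianTranslates_le [Fintype κ] [DecidableEq τ] {B : Matrix τ ι ℂ}
    {C : Matrix τ σ ℂ} (h : B * Bᴴ + C * Cᴴ = 1) {w : κ → ENNReal} (hw : ∀ k, w k ≠ ⊤)
    (x : κ → ι → ℂ) (z : τ → ℂ) :
    condEntropy (gaussianTranslates w x)
      ≤ condEntropy (gaussianTranslates w fun k => z + B *ᵥ x k) := by
  have := isFiniteMeasure_gaussianTranslates hw x
  refine (condEntropy_le_map_prod _ (gaussianPi σ)
    (g := fun q => z + (B *ᵥ q.1 + C *ᵥ q.2)) (Continuous.measurable (by fun_prop))).trans_eq ?_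
  congr 1
  ext1 k
  exact map_gaussianTranslates_prod h w x z k

/-- The variant of `condEntropy_gaussianTranslates_le` in which only a part of the index is of
interest. -/
lemma condEntropy_sum_gaussianTranslates_le [Fintype κ] {κ' : Type*} [Fintype κ'] [DecidableEq τ]
    {B : Matrix τ ι ℂ} {C : Matrix τ σ ℂ} (h : B * Bᴴ + C * Cᴴ = 1) {w : κ × κ' → ENNReal}
    (hw : ∀ k, w k ≠ ⊤) (x : κ × κ' → ι → ℂ) :
    condEntropy (fun j => ∑ i, gaussianTranslates w x (i, j))
      ≤ condEntropy (fun j => ∑ i, gaussianTranslates w (fun k => B *ᵥ x k) (i, j)) := by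
  have := isFiniteMeasure_gaussianTranslates hw x
  have hm : Measurable fun q : (ι → ℂ) × (σ → ℂ) => 0 + (B *ᵥ q.1 + C *ᵥ q.2) :=
    Continuous.measurable (by fun_prop)
  refine (condEntropy_le_map_prod _ (gaussianPi σ) hm).trans_eq ?_
  congr 1
  ext1 j
  rw [← Measure.sum_fintype, Measure.prod_sum_left, Measure.map_sum hm.aemeasurable,
    Measure.sum_fintype]
  refine Finset.sum_congr rfl fun i _ => ?_
  simpa only [zero_add] using map_gaussianTranslates_prod h w x 0 (i, j)

lemma condEntropy_gaussianTranslates_add [Fintype κ] {w : κ → ENNReal} (hw : ∀ k, w k ≠ ⊤)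
    (x : κ → ι → ℂ) (z : ι → ℂ) :
    condEntropy (gaussianTranslates w fun k => z + x k) = condEntropy (gaussianTranslates w x) := by
  classical
  have h : (1 : Matrix ι ι ℂ) * 1ᴴ + (0 : Matrix ι ι ℂ) * 0ᴴ = 1 := by simp
  refine le_antisymm ?_ ?_
  · simpa using condEntropy_gaussianTranslates_le h hw (fun k => z + x k) (-z)
  · simpa using condEntropy_gaussianTranslates_le h hw x z

/-- The uncertainty about `u` given `u a + G` depends on the vector `a` only through its norm. -/
lemma condEntropy_gaussianTranslates_smul [Fintype κ] {w : κ → ENNReal} (hw : ∀ k, w k ≠ ⊤)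
    (u : κ → ℂ) (a : ι → ℂ) {r : ℝ} (hr : 0 < r) (ha : ∑ i, ‖a i‖ ^ 2 = r ^ 2) :
    condEntropy (gaussianTranslates w fun k => u k • a)
      = condEntropy (gaussianTranslates w fun k (_ : Unit) => (r : ℂ) * u k) := by
  classical
  have hr' : (r : ℂ) ≠ 0 := by exact_mod_cast hr.ne'
  obtain ⟨b, hb⟩ : ∃ b : Matrix ι Unit ℂ, ∀ i j, b i j = a i / r :=
    ⟨Matrix.of fun i _ => a i / r, fun _ _ => rfl⟩
  have haa : ∑ i, (starRingEnd ℂ) (a i) * a i = (r : ℂ) ^ 2 := by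
    have : ∀ i, (starRingEnd ℂ) (a i) * a i = ((‖a i‖ ^ 2 : ℝ) : ℂ) := fun i => by
      rw [mul_comm, Complex.mul_conj, Complex.normSq_eq_norm_sq]
    simp_rw [this]
    rw [← Complex.ofReal_sum, ha]
    push_cast
    rfl
  have hbb : bᴴ * b = 1 := by
    ext i j
    simp only [mul_apply, conjTranspose_apply, hb, one_apply, star_div₀, Complex.star_def,
      Complex.conj_ofReal]
    simp_rw [div_mul_div_comm]
    rw [← Finset.sum_div, haa]
    simp only [if_true]
    field_simp
  -- Projecting on the direction `b` of `a` keeps the relevant coordinate; conversely, the other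
  -- coordinates of the noise are supplied by the independent Gaussian vector `(1 - b bᴴ) G`.
  refine le_antisymm ?_ ?_
  · have h : bᴴ * bᴴᴴ + (0 : Matrix Unit Unit ℂ) * 0ᴴ = 1 := by simp [hbb]
    refine (condEntropy_gaussianTranslates_le h hw (fun k => u k • a) 0).trans_eq ?_
    congr 2
    ext k i
    simp only [zero_add, mulVec_smul, Pi.smul_apply, smul_eq_mul, mulVec, dotProduct,
      conjTranspose_apply, hb, star_div₀, Complex.star_def, Complex.conj_ofReal]
    simp_rw [div_mul_eq_mul_div]
    rw [← Finset.sum_div, haa]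
    field_simp
  · have h : b * bᴴ + (1 - b * bᴴ) * (1 - b * bᴴ)ᴴ = 1 := by
      have e : b * bᴴ * (b * bᴴ) = b * bᴴ := by
        rw [Matrix.mul_assoc, ← Matrix.mul_assoc bᴴ, hbb, Matrix.one_mul]
      simp only [conjTranspose_sub, conjTranspose_one, conjTranspose_mul,
        conjTranspose_conjTranspose, Matrix.sub_mul, Matrix.mul_sub, Matrix.one_mul,
        Matrix.mul_one, e]
      abel
    refine (condEntropy_gaussianTranslates_le h hw
      (fun k (_ : Unit) => (r : ℂ) * u k) 0).trans_eq ?_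
    congr 2
    ext k i
    simp only [zero_add, mulVec, dotProduct, hb, Pi.smul_apply, smul_eq_mul, Finset.univ_unique,
      Finset.sum_const, Finset.card_singleton, one_smul]
    field_simp

lemma condEntropy_gaussianTranslates_unit [Fintype κ] {w : κ → ENNReal} (hw : ∀ k, w k ≠ ⊤)
    (x : κ → ℂ) :
    condEntropy (gaussianTranslates w fun k (_ : Unit) => x k)
      = condEntropy fun k => w k • complexGaussian.map fun y => x k + y := by
  have := isFiniteMeasure_gaussianTranslates hw fun k (_ : Unit) => x k
  have hmp : MeasurePreserving (MeasurableEquiv.funUnique Unit ℂ) (gaussianPi Unit)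
      complexGaussian := measurePreserving_funUnique complexGaussian Unit
  have e : ∀ k, (gaussianTranslates w (fun k (_ : Unit) => x k) k).map
      (MeasurableEquiv.funUnique Unit ℂ) = w k • complexGaussian.map fun y => x k + y := by
    intro k
    rw [gaussianTranslates, Measure.map_smul, Measure.map_map (by fun_prop) (by fun_prop),
      ← hmp.map_eq, Measure.map_map (by fun_prop) (by fun_prop)]
    rfl
  have e' : ∀ k, (w k • complexGaussian.map fun y => x k + y).map
      (MeasurableEquiv.funUnique Unit ℂ).symm
        = gaussianTranslates w (fun k (_ : Unit) => x k) k := by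
    intro k
    rw [← e, MeasurableEquiv.map_symm_map]
  have hfin : ∀ k, IsFiniteMeasure (w k • complexGaussian.map fun y => x k + y) := fun k => by
    rw [← e]; infer_instance
  refine le_antisymm ?_ ?_
  · refine (condEntropy_le_map _ (MeasurableEquiv.funUnique Unit ℂ).measurable).trans_eq ?_
    simp_rw [e]
  · refine (condEntropy_le_map _ (MeasurableEquiv.funUnique Unit ℂ).symm.measurable).trans_eq ?_
    simp_rw [e']

end Gaussian

/-! ### Entropy of smoothed laws -/

section SmoothedLaw

variable {m : ℕ}

lemma map_add_complexGaussian (x : ℂ) :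
    complexGaussian.map (fun y => x + y) = volume.withDensity
      (fun z : ℂ => ENNReal.ofReal (Real.exp (-‖z - x‖ ^ 2 / 2) / (2 * Real.pi))) := by
  have hmp : MeasurePreserving (fun y : ℂ => x + y) volume volume :=
    measurePreserving_add_left volume x
  rw [complexGaussian]
  ext s hs
  rw [Measure.map_apply (by fun_prop) hs, withDensity_apply _ (by measurability),
    withDensity_apply _ hs, ← hmp.setLIntegral_comp_preimage hs (by fun_prop)]
  simp

lemma rnDeriv_smul_map_add_complexGaussian {a : ℝ} (ha : 0 ≤ a) (x : ℂ) :
    (ENNReal.ofReal a • complexGaussian.map (fun y => x + y)).rnDeriv volume =ᵐ[volume]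
      fun z => ENNReal.ofReal (a * (Real.exp (-‖z - x‖ ^ 2 / 2) / (2 * Real.pi))) := by
  rw [map_add_complexGaussian, ← withDensity_smul _ (by fun_prop)]
  refine (Measure.rnDeriv_withDensity _ (by fun_prop)).trans (ae_of_all _ fun z => ?_)
  exact (ENNReal.ofReal_mul ha).symm

lemma integrable_negMulLog_gaussianDensity (a : ℝ) : Integrable fun z : ℂ =>
    Real.negMulLog (a * (Real.exp (-‖z‖ ^ 2 / 2) / (2 * Real.pi))) := by
  -- `‖z‖² exp (-‖z‖² / 2)` is dominated by `4 exp (-‖z‖² / 4)`.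
  have h4 : Integrable fun z : ℂ => Real.exp (-(1 / 4) * ‖z‖ ^ 2) := by
    refine Integrable.of_integral_ne_zero ?_
    rw [GaussianFourier.integral_rexp_neg_mul_sq_norm (by norm_num)]
    positivity
  have h5 : Integrable fun z : ℂ =>
      ‖z‖ ^ 2 * (Real.exp (-‖z‖ ^ 2 / 2) / (2 * Real.pi)) := by
    refine Integrable.mono' (h4.const_mul 4) (by fun_prop) (ae_of_all _ fun z => ?_)
    have h1 : ‖z‖ ^ 2 / 4 ≤ Real.exp (‖z‖ ^ 2 / 4) := by
      linarith [Real.add_one_le_exp (‖z‖ ^ 2 / 4)]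
    have h2 : Real.exp (-‖z‖ ^ 2 / 2) * Real.exp (‖z‖ ^ 2 / 4)
        = Real.exp (-(1 / 4) * ‖z‖ ^ 2) := by
      rw [← Real.exp_add]; congr 1; ring
    have h3 := Real.exp_pos (-‖z‖ ^ 2 / 2)
    have hpi : 1 ≤ 2 * Real.pi := by linarith [Real.pi_gt_three]
    rw [Real.norm_of_nonneg (by positivity), ← h2]
    calc ‖z‖ ^ 2 * (Real.exp (-‖z‖ ^ 2 / 2) / (2 * Real.pi))
        ≤ ‖z‖ ^ 2 * Real.exp (-‖z‖ ^ 2 / 2) := by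
          gcongr
          exact div_le_self h3.le hpi
      _ ≤ _ := by nlinarith
  have e : ∀ z : ℂ, Real.negMulLog (a * (Real.exp (-‖z‖ ^ 2 / 2) / (2 * Real.pi)))
      = (Real.negMulLog a + a * Real.log (2 * Real.pi)) *
          (Real.exp (-‖z‖ ^ 2 / 2) / (2 * Real.pi))
        + a / 2 * (‖z‖ ^ 2 * (Real.exp (-‖z‖ ^ 2 / 2) / (2 * Real.pi))) := by
    intro z
    rw [Real.negMulLog_mul, Real.negMulLog.eq_1 (Real.exp _ / _), Real.log_div (by positivity)
      (by positivity), Real.log_exp]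
    ring
  simp_rw [e]
  exact (integrable_gaussianDensity.const_mul _).add (h5.const_mul _)

lemma integrable_negMulLog_rnDeriv_smul_map_add {a : ℝ} (ha : 0 ≤ a) (x : ℂ) :
    Integrable fun z => Real.negMulLog
      (((ENNReal.ofReal a • complexGaussian.map (fun y => x + y)).rnDeriv volume z).toReal) := by
  refine ((integrable_negMulLog_gaussianDensity a).comp_sub_right x).congr ?_
  filter_upwards [rnDeriv_smul_map_add_complexGaussian ha x] with z hz
  rw [hz, ENNReal.toReal_ofReal (by positivity)]

lemma densityEntropy_smul_map_add {a : ℝ} (ha : 0 ≤ a) (x : ℂ) :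
    densityEntropy (ENNReal.ofReal a • complexGaussian.map (fun y => x + y)) volume
      = ∫ z : ℂ, Real.negMulLog (a * (Real.exp (-‖z‖ ^ 2 / 2) / (2 * Real.pi))) := by
  rw [← integral_sub_right_eq_self _ x, densityEntropy]
  refine integral_congr_ae ?_
  filter_upwards [rnDeriv_smul_map_add_complexGaussian ha x] with z hz
  rw [hz, ENNReal.toReal_ofReal (by positivity)]

instance isFiniteMeasure_ofReal_smul_map (a : ℝ) (x : ℂ) :
    IsFiniteMeasure (ENNReal.ofReal a • complexGaussian.map fun y => x + y) := by
  have : IsProbabilityMeasure (complexGaussian.map fun y => x + y) :=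
    Measure.isProbabilityMeasure_map (by fun_prop)
  exact Measure.smul_finite _ ENNReal.ofReal_ne_top

lemma smoothedLaw_atomicMeasure (p : Fin m → ℝ) (u : Fin m → ℂ) (c : ℝ) :
    smoothedLaw (atomicMeasure p u) c
      = ∑ j, ENNReal.ofReal (p j) • complexGaussian.map fun y => (c : ℂ) * u j + y := by
  have hm : Measurable fun q : ℂ × ℂ => (c : ℂ) * q.1 + q.2 := by fun_prop
  rw [smoothedLaw, atomicMeasure, ← Measure.sum_fintype, Measure.prod_sum_left,
    Measure.map_sum hm.aemeasurable, Measure.sum_fintype]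
  refine Finset.sum_congr rfl fun j _ => ?_
  rw [Measure.prod_smul_left, Measure.map_smul, Measure.dirac_prod,
    Measure.map_map hm (by fun_prop)]
  rfl

lemma sum_smul_map_absolutelyContinuous (p : Fin m → ℝ) (x : Fin m → ℂ) :
    (∑ j, ENNReal.ofReal (p j) • complexGaussian.map fun y => x j + y) ≪ volume := by
  rw [← Measure.sum_fintype]
  refine Measure.absolutelyContinuous_sum_left fun j => ?_
  refine Measure.AbsolutelyContinuous.smul_left ?_ _
  rw [map_add_complexGaussian]
  exact withDensity_absolutelyContinuous _ _

lemma hasDifferentialEntropy_smoothedLaw {p : Fin m → ℝ} (hp : ∀ j, 0 ≤ p j) (u : Fin m → ℂ)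
    (c : ℝ) : HasDifferentialEntropy (smoothedLaw (atomicMeasure p u) c) := by
  rw [smoothedLaw_atomicMeasure]
  have h := sum_smul_map_absolutelyContinuous p fun j => (c : ℂ) * u j
  exact ⟨h, integrable_negMulLog_rnDeriv_sum _ _ h
    fun j => integrable_negMulLog_rnDeriv_smul_map_add (hp j) _⟩

/-- `H(c ξ + G) + H(ξ | c ξ + G) = H(ξ) + H(G)`; the right side does not depend on `c`. -/
lemma differentialEntropy_smoothedLaw_add_condEntropy {p : Fin m → ℝ} (hp : ∀ j, 0 ≤ p j)
    (u : Fin m → ℂ) (c : ℝ) :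
    differentialEntropy (smoothedLaw (atomicMeasure p u) c)
      + condEntropy (fun j => ENNReal.ofReal (p j) •
          complexGaussian.map fun y => (c : ℂ) * u j + y)
      = ∑ j, ∫ z : ℂ, Real.negMulLog (p j * (Real.exp (-‖z‖ ^ 2 / 2) / (2 * Real.pi))) := by
  rw [smoothedLaw_atomicMeasure]
  have h := sum_densityEntropy_eq_add_condEntropy _ _
    (sum_smul_map_absolutelyContinuous p fun j => (c : ℂ) * u j)
    fun j => integrable_negMulLog_rnDeriv_smul_map_add (hp j) _
  refine h.symm.trans (Finset.sum_congr rfl fun j _ => ?_)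
  exact densityEntropy_smul_map_add (hp j) _

end SmoothedLaw

/-! ### Unitary matrices with prescribed eigenvalues in a corner -/

section AllPass

open Matrix Polynomial

/-- A cascade of plane rotations: given points `β` of the unit disc, there is a unitary matrix
with blocks `A`, `v`, `w`, `D` such that `A` has the eigenvalues `β` and `|D| = ∏ |β|`. Of the
unitarity only the identities for the blocks which are needed later are recorded. -/
lemma exists_unitary_blocks (s : Multiset ℂ) (hs : ∀ β ∈ s, ‖β‖ ≤ 1) :
    ∃ (ι : Type) (_ : Fintype ι) (_ : DecidableEq ι) (A : Matrix ι ι ℂ) (v : Matrix ι Unit ℂ)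
      (w : Matrix Unit ι ℂ) (D : ℂ),
      A * Aᴴ + v * vᴴ = 1 ∧ A * wᴴ + star D • v = 0 ∧ w * wᴴ + (D * star D) • 1 = 1 ∧
      vᴴ * v + (D * star D) • 1 = 1 ∧ A.charpoly = (s.map fun β => X - C β).prod ∧
      A.det = s.prod ∧ ‖D‖ = (s.map fun β => ‖β‖).prod := by
  induction s using Multiset.induction_on with
  | empty =>
    refine ⟨Empty, inferInstance, inferInstance, 0, 0, 0, 1, ?_, ?_, ?_, ?_, ?_, ?_, ?_⟩
    any_goals simp
    · ext i; exact i.elim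
  | cons β s ih =>
    obtain ⟨ι, _, _, A, v, w, D, h1, h2, h3, h4, h5, h6, h7⟩ :=
      ih fun b hb => hs b (Multiset.mem_cons_of_mem hb)
    have hβ : ‖β‖ ≤ 1 := hs β (Multiset.mem_cons_self _ _)
    obtain ⟨ρ, hρs, hρ⟩ : ∃ ρ : ℂ, star ρ = ρ ∧ ρ * ρ + β * star β = 1 := by
      refine ⟨(Real.sqrt (1 - ‖β‖ ^ 2) : ℝ), Complex.conj_ofReal _, ?_⟩
      rw [Complex.star_def, Complex.mul_conj, Complex.normSq_eq_norm_sq, ← Complex.ofReal_mul,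
        Real.mul_self_sqrt (by nlinarith [norm_nonneg β])]
      push_cast
      ring
    have h2' : w * Aᴴ + D • vᴴ = 0 := by
      have := congrArg conjTranspose h2
      simpa using this
    have h2a : A * wᴴ = -(star D • v) := eq_neg_of_add_eq_zero_left h2
    have h2b : w * Aᴴ = -(D • vᴴ) := eq_neg_of_add_eq_zero_left h2'
    have h3a : w * wᴴ = (1 - D * star D) • (1 : Matrix Unit Unit ℂ) := by
      rw [sub_smul, one_smul]; exact eq_sub_of_add_eq h3
    have h4a : vᴴ * v = (1 - D * star D) • (1 : Matrix Unit Unit ℂ) := by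
      rw [sub_smul, one_smul]; exact eq_sub_of_add_eq h4
    -- The output of the system for `s` is fed into the rotation `[β, ρ; ρ, -β*]`.
    refine ⟨ι ⊕ Unit, inferInstance, inferInstance, fromBlocks A 0 (ρ • w) (β • 1),
      fromRows v ((ρ * D) • 1), fromCols (-star β • w) (ρ • 1), -star β * D,
      ?_, ?_, ?_, ?_, ?_, ?_, ?_⟩
    · rw [fromBlocks_conjTranspose, fromBlocks_multiply,
        conjTranspose_fromRows_eq_fromCols_conjTranspose, fromRows_mul_fromCols, fromBlocks_add,
        ← fromBlocks_one]
      congr 1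
      · simpa using h1
      · simp [h2a, hρs, smul_smul]
      · simp [h2b, smul_smul]
      · simp only [conjTranspose_smul, conjTranspose_one, Matrix.smul_mul, Matrix.mul_smul, h3a,
          smul_smul, ← add_smul, Matrix.mul_one, hρs, star_mul]
        rw [show ρ * (ρ * (1 - D * star D)) + star β * β + star D * ρ * (ρ * D) = 1 by
          linear_combination hρ, one_smul]
    · have e1 : A * (-star β • w)ᴴ +
          (0 : Matrix ι Unit ℂ) * (ρ • (1 : Matrix Unit Unit ℂ))ᴴ = (β * star D) • v := by
        simp [h2a, smul_smul]
      have e2 : ρ • w * (-star β • w)ᴴ + (β • 1) * (ρ • (1 : Matrix Unit Unit ℂ))ᴴ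
          = (ρ * β * (D * star D)) • 1 := by
        simp only [conjTranspose_smul, conjTranspose_one, Matrix.smul_mul, Matrix.mul_smul, h3a,
          smul_smul, ← add_smul, Matrix.mul_one, hρs, star_neg, star_star]
        congr 1
        ring
      rw [conjTranspose_fromCols_eq_fromRows_conjTranspose, fromBlocks_mul_fromRows, e1, e2]
      ext (i | i) j
      · simp
      · simp
        ring
    · rw [conjTranspose_fromCols_eq_fromRows_conjTranspose, fromCols_mul_fromRows]
      simp only [conjTranspose_smul, conjTranspose_one, Matrix.smul_mul, Matrix.mul_smul, h3a,
        smul_smul, ← add_smul, Matrix.mul_one, hρs, star_neg, star_star, star_mul]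
      rw [← one_smul ℂ (1 : Matrix Unit Unit ℂ), smul_smul]
      congr 1
      linear_combination hρ
    · rw [conjTranspose_fromRows_eq_fromCols_conjTranspose, fromCols_mul_fromRows]
      simp only [conjTranspose_smul, conjTranspose_one, Matrix.mul_smul, h4a,
        smul_smul, ← add_smul, Matrix.mul_one, hρs, star_neg, star_star, star_mul]
      rw [← one_smul ℂ (1 : Matrix Unit Unit ℂ), smul_smul]
      congr 1
      linear_combination D * star D * hρ
    · rw [charpoly_fromBlocks_zero₁₂, h5, Multiset.map_cons, Multiset.prod_cons, mul_comm,
        smul_one_eq_diagonal, charpoly_diagonal]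
      simp
    · rw [det_fromBlocks_zero₁₂, h6]
      simp [mul_comm]
    · rw [norm_mul, norm_neg, norm_star, h7]
      simp

end AllPass

/-! ### Entropy of atomic laws -/

section Atomic

variable {κ κ' Y : Type*} [Fintype κ] [Fintype κ']

/-- The probability of the atom `y a`, for the law which gives the weight `q b` to `y b`. -/
def fiberWeight [DecidableEq Y] (q : κ → ℝ) (y : κ → Y) (a : κ) : ℝ :=
  ∑ b, if y b = y a then q b else 0

/-- The Shannon entropy of the law which gives the weight `q a` to `y a`, as a sum over the
index `a`. -/
def atomicEntropy [DecidableEq Y] (q : κ → ℝ) (y : κ → Y) : ℝ :=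
  ∑ a, q a * -Real.log (fiberWeight q y a)

lemma le_fiberWeight [DecidableEq Y] {q : κ → ℝ} (hq : ∀ a, 0 ≤ q a) (y : κ → Y) (a : κ) :
    q a ≤ fiberWeight q y a := by
  have := Finset.single_le_sum (f := fun b => if y b = y a then q b else 0)
    (fun b _ => by split_ifs <;> simp [hq]) (Finset.mem_univ a)
  simpa [fiberWeight] using this

lemma fiberWeight_le_one [DecidableEq Y] {q : κ → ℝ} (hq : ∀ a, 0 ≤ q a) (hq1 : ∑ a, q a = 1)
    (y : κ → Y) (a : κ) : fiberWeight q y a ≤ 1 := by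
  rw [← hq1]
  exact Finset.sum_le_sum fun b _ => by split_ifs <;> simp [hq]

lemma atomicEntropy_nonneg [DecidableEq Y] {q : κ → ℝ} (hq : ∀ a, 0 ≤ q a)
    (hq1 : ∑ a, q a = 1) (y : κ → Y) : 0 ≤ atomicEntropy q y := by
  refine Finset.sum_nonneg fun a _ => mul_nonneg (hq a) ?_
  rw [neg_nonneg]
  exact Real.log_nonpos ((hq a).trans (le_fiberWeight hq y a)) (fiberWeight_le_one hq hq1 y a)

lemma atomicEntropy_comp_equiv [DecidableEq Y] (e : κ' ≃ κ) (q : κ → ℝ) (y : κ → Y) :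
    atomicEntropy (fun a => q (e a)) (fun a => y (e a)) = atomicEntropy q y := by
  unfold atomicEntropy fiberWeight
  rw [← Equiv.sum_comp e]
  refine Finset.sum_congr rfl fun a _ => ?_
  rw [← Equiv.sum_comp e]

/-- Subadditivity: a function of a pair of independent variables has at most the sum of their
entropies. -/
lemma atomicEntropy_prod_le {Y₁ Y₂ : Type*} [DecidableEq Y] [DecidableEq Y₁] [DecidableEq Y₂]
    {q : κ → ℝ} {q' : κ' → ℝ} (hq : ∀ a, 0 ≤ q a) (hq1 : ∑ a, q a = 1) (hq' : ∀ a, 0 ≤ q' a)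
    (hq'1 : ∑ a, q' a = 1) (y₁ : κ → Y₁) (y₂ : κ' → Y₂) (f : Y₁ → Y₂ → Y) :
    atomicEntropy (fun c : κ × κ' => q c.1 * q' c.2) (fun c => f (y₁ c.1) (y₂ c.2))
      ≤ atomicEntropy q y₁ + atomicEntropy q' y₂ := by
  have key : ∀ a b, fiberWeight q y₁ a * fiberWeight q' y₂ b
      ≤ fiberWeight (fun c : κ × κ' => q c.1 * q' c.2) (fun c => f (y₁ c.1) (y₂ c.2)) (a, b) := by
    intro a b
    unfold fiberWeight
    rw [Finset.sum_mul_sum, Fintype.sum_prod_type]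
    refine Finset.sum_le_sum fun a' _ => Finset.sum_le_sum fun b' _ => ?_
    have := mul_nonneg (hq a') (hq' b')
    dsimp only
    by_cases h1 : y₁ a' = y₁ a
    · by_cases h2 : y₂ b' = y₂ b
      · simp [h1, h2]
      · simp only [h2, if_false, mul_zero]
        split_ifs <;> simp [this]
    · simp only [h1, if_false, zero_mul]
      split_ifs <;> simp [this]
  have e : atomicEntropy q y₁ + atomicEntropy q' y₂ = ∑ c : κ × κ', q c.1 * q' c.2 *
      (-Real.log (fiberWeight q y₁ c.1) + -Real.log (fiberWeight q' y₂ c.2)) := by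
    have e1 : atomicEntropy q y₁ = ∑ a, ∑ b, q a * q' b * -Real.log (fiberWeight q y₁ a) := by
      unfold atomicEntropy
      refine Finset.sum_congr rfl fun a _ => ?_
      rw [← Finset.sum_mul, ← Finset.mul_sum, hq'1, mul_one]
    have e2 : atomicEntropy q' y₂ = ∑ a, ∑ b, q a * q' b * -Real.log (fiberWeight q' y₂ b) := by
      unfold atomicEntropy
      rw [Finset.sum_comm]
      refine Finset.sum_congr rfl fun b _ => ?_
      rw [← Finset.sum_mul, ← Finset.sum_mul, hq1, one_mul]
    rw [e1, e2, Fintype.sum_prod_type, ← Finset.sum_add_distrib]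
    refine Finset.sum_congr rfl fun a _ => ?_
    rw [← Finset.sum_add_distrib]
    exact Finset.sum_congr rfl fun b _ => by ring
  rw [e]
  refine Finset.sum_le_sum fun c _ => ?_
  rcases (mul_nonneg (hq c.1) (hq' c.2)).eq_or_lt with h0 | h0
  · simp [← h0]
  · refine mul_le_mul_of_nonneg_left ?_ h0.le
    have ha : 0 < fiberWeight q y₁ c.1 :=
      (pos_of_mul_pos_left h0 (hq' _)).trans_le (le_fiberWeight hq _ _)
    have hb : 0 < fiberWeight q' y₂ c.2 :=
      (pos_of_mul_pos_right h0 (hq _)).trans_le (le_fiberWeight hq' _ _)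
    rw [← neg_add, ← Real.log_mul ha.ne' hb.ne']
    exact neg_le_neg (Real.log_le_log (mul_pos ha hb) (key c.1 c.2))

lemma shannonEntropy_sum_dirac {q : κ → ℝ} (hq : ∀ a, 0 ≤ q a) (y : κ → ℂ) :
    shannonEntropy (∑ a, ENNReal.ofReal (q a) • Measure.dirac (y a)) = atomicEntropy q y := by
  classical
  have hr : ∀ x : ℂ, (∑ a, ENNReal.ofReal (q a) • Measure.dirac (y a)).real {x}
      = ∑ a, if y a = x then q a else 0 := by
    intro x
    rw [measureReal_def, Measure.coe_finsetSum, Finset.sum_apply, ENNReal.toReal_sum]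
    · refine Finset.sum_congr rfl fun a _ => ?_
      by_cases h : y a = x
      · simp [h, hq a]
      · simp [h]
    · intro a _
      exact ENNReal.mul_ne_top ENNReal.ofReal_ne_top (measure_ne_top _ _)
  unfold shannonEntropy
  simp_rw [hr]
  rw [tsum_eq_sum (s := Finset.univ.image y)]
  · unfold atomicEntropy
    refine Finset.sum_image' _ fun a _ => ?_
    rw [Real.negMulLog, neg_mul_comm, Finset.sum_mul, Finset.sum_filter]
    refine Finset.sum_congr rfl fun b _ => ?_
    by_cases h : y b = y a
    · simp only [h, if_true, fiberWeight]
    · simp [h]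
  · intro x hx
    rw [Finset.sum_eq_zero, Real.negMulLog_zero]
    intro a _
    rw [if_neg]
    rintro rfl
    exact hx (Finset.mem_image_of_mem _ (Finset.mem_univ _))

/-- If the law of `Y` given `ξ` depends on `ξ` only through `y ξ`, then
`H(ξ | Y) ≥ H(ξ) - H(y ξ)`. -/
lemma sum_negMulLog_sub_atomicEntropy_le_condEntropy {E : Type*} [MeasurableSpace E]
    [DecidableEq Y] {q : κ → ℝ} (hq : ∀ a, 0 ≤ q a) (y : κ → Y) (μ : κ → Measure E)
    [∀ a, IsProbabilityMeasure (μ a)] (hμ : ∀ a b, y a = y b → μ a = μ b) :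
    ∑ a, Real.negMulLog (q a) - atomicEntropy q y
      ≤ condEntropy fun a => ENNReal.ofReal (q a) • μ a := by
  have hfin : ∀ a, IsFiniteMeasure (ENNReal.ofReal (q a) • μ a) :=
    fun a => Measure.smul_finite _ ENNReal.ofReal_ne_top
  unfold atomicEntropy condEntropy
  rw [← Finset.sum_sub_distrib]
  refine Finset.sum_le_sum fun a _ => ?_
  rcases (hq a).eq_or_lt with h0 | h0
  · dsimp only
    rw [← h0, ENNReal.ofReal_zero, zero_smul, densityEntropy_zero_left]
    simp
  have hP : 0 < fiberWeight q y a := h0.trans_le (le_fiberWeight hq y a)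
  have hle : ENNReal.ofReal (fiberWeight q y a) • μ a ≤ ∑ b, ENNReal.ofReal (q b) • μ b := by
    unfold fiberWeight
    rw [ENNReal.ofReal_sum_of_nonneg (fun b _ => by split_ifs <;> simp [hq]), Finset.sum_smul]
    refine Finset.sum_le_sum fun b _ => ?_
    split_ifs with h
    · rw [hμ b a h]
    · rw [ENNReal.ofReal_zero, zero_smul]
      exact Measure.zero_le _
  have hc : ENNReal.ofReal (q a) • μ a ≤ ENNReal.ofReal (q a / fiberWeight q y a) •
      ∑ b, ENNReal.ofReal (q b) • μ b := by
    calc ENNReal.ofReal (q a) • μ a = ENNReal.ofReal (q a / fiberWeight q y a) •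
          ENNReal.ofReal (fiberWeight q y a) • μ a := by
          rw [smul_smul, ← ENNReal.ofReal_mul (by positivity), div_mul_cancel₀ _ hP.ne']
      _ ≤ _ := by gcongr
  have := mul_neg_log_le_densityEntropy
    (le_sum_measure (fun a => ENNReal.ofReal (q a) • μ a) a) hc
  refine le_trans (le_of_eq ?_) this
  rw [Real.log_div h0.ne' hP.ne', measureReal_ennreal_smul_apply, probReal_univ,
    ENNReal.toReal_ofReal (hq a), Real.negMulLog]
  ring

end Atomic

/-! ### Words and the existence of the Garsia entropy -/

section Words

variable {m : ℕ}

lemma sum_prod_weight {p : Fin m → ℝ} (hp1 : ∑ j, p j = 1) (n : ℕ) :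
    ∑ a : Fin n → Fin m, ∏ j, p (a j) = 1 := by
  classical
  rw [← Fintype.piFinset_univ, ← Finset.prod_univ_sum]
  simp [hp1]

lemma garsiaLaw_atomicMeasure (η : ℂ) {p : Fin m → ℝ} (hp : ∀ j, 0 ≤ p j) (u : Fin m → ℂ)
    (n : ℕ) : garsiaLaw η (atomicMeasure p u) n = ∑ a : Fin n → Fin m,
      ENNReal.ofReal (∏ j, p (a j)) • Measure.dirac (∑ j : Fin n, u (a j) * η ^ (j : ℕ)) := by
  classical
  have hfin : IsFiniteMeasure (atomicMeasure p u) := by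
    unfold atomicMeasure
    have : ∀ j, IsFiniteMeasure (ENNReal.ofReal (p j) • Measure.dirac (u j)) :=
      fun j => Measure.smul_finite _ ENNReal.ofReal_ne_top
    infer_instance
  have hpi : Measure.pi (fun _ : Fin n => atomicMeasure p u) = ∑ a : Fin n → Fin m,
      ENNReal.ofReal (∏ j, p (a j)) • Measure.dirac (fun j => u (a j)) := by
    refine (Measure.pi_eq fun s hs => ?_)
    rw [Measure.coe_finsetSum, Finset.sum_apply]
    simp only [atomicMeasure, Measure.coe_finsetSum, Finset.sum_apply]
    rw [Finset.prod_univ_sum, Fintype.piFinset_univ]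
    refine Finset.sum_congr rfl fun a _ => ?_
    rw [Measure.smul_apply, Measure.dirac_apply' _ (MeasurableSet.univ_pi hs), smul_eq_mul,
      ENNReal.ofReal_prod_of_nonneg (fun _ _ => hp _)]
    simp only [Measure.smul_apply, Measure.dirac_apply' _ (hs _), smul_eq_mul,
      Finset.prod_mul_distrib]
    congr 1
    by_cases h : ∀ j, u (a j) ∈ s j
    · rw [Set.indicator_of_mem (by simpa using h)]
      simp [h]
    · rw [Set.indicator_of_notMem (by simpa using h)]
      push Not at h
      obtain ⟨j, hj⟩ := h
      exact (Finset.prod_eq_zero (Finset.mem_univ j) (Set.indicator_of_notMem hj _)).symm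
  have hm : Measurable fun ξ : Fin n → ℂ => ∑ j : Fin n, ξ j * η ^ (j : ℕ) := by fun_prop
  rw [garsiaLaw, hpi, ← Measure.sum_fintype, Measure.map_sum hm.aemeasurable, Measure.sum_fintype]
  refine Finset.sum_congr rfl fun a _ => ?_
  rw [Measure.map_smul, Measure.map_dirac' hm]

lemma shannonEntropy_garsiaLaw (η : ℂ) {p : Fin m → ℝ} (hp : ∀ j, 0 ≤ p j) (u : Fin m → ℂ)
    (n : ℕ) : shannonEntropy (garsiaLaw η (atomicMeasure p u) n)
      = atomicEntropy (fun a : Fin n → Fin m => ∏ j, p (a j))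
          fun a => ∑ j : Fin n, u (a j) * η ^ (j : ℕ) := by
  rw [garsiaLaw_atomicMeasure η hp, shannonEntropy_sum_dirac]
  exact fun a => Finset.prod_nonneg fun _ _ => hp _

lemma subadditive_shannonEntropy_garsiaLaw (η : ℂ) {p : Fin m → ℝ} (hp : ∀ j, 0 ≤ p j)
    (hp1 : ∑ j, p j = 1) (u : Fin m → ℂ) :
    Subadditive fun n => shannonEntropy (garsiaLaw η (atomicMeasure p u) n) := by
  intro n k
  simp_rw [shannonEntropy_garsiaLaw η hp]
  rw [← atomicEntropy_comp_equiv (Fin.appendEquiv n k)]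
  refine le_trans (le_of_eq ?_) (atomicEntropy_prod_le
    (fun a : Fin n → Fin m => Finset.prod_nonneg fun _ _ => hp _) (sum_prod_weight hp1 n)
    (fun a : Fin k → Fin m => Finset.prod_nonneg fun _ _ => hp _) (sum_prod_weight hp1 k)
    _ _ fun x y => x + η ^ n * y)
  congr 1
  · ext c
    simp [Fin.prod_univ_add, Fin.appendEquiv]
  · ext c
    simp only [Fin.sum_univ_add, Fin.appendEquiv, Finset.mul_sum]
    simp [pow_add, mul_left_comm]

lemma tendsto_garsiaEntropy (η : ℂ) {p : Fin m → ℝ} (hp : ∀ j, 0 ≤ p j)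
    (hp1 : ∑ j, p j = 1) (u : Fin m → ℂ) :
    Tendsto (fun n : ℕ => shannonEntropy (garsiaLaw η (atomicMeasure p u) n) / n) atTop
      (𝓝 (garsiaEntropy η (atomicMeasure p u))) := by
  refine tendsto_nhds_limUnder ⟨_, (subadditive_shannonEntropy_garsiaLaw η hp hp1 u).tendsto_lim
    ⟨0, ?_⟩⟩
  rintro _ ⟨n, rfl⟩
  dsimp only
  rw [shannonEntropy_garsiaLaw η hp]
  exact div_nonneg (atomicEntropy_nonneg (fun a => Finset.prod_nonneg fun _ _ => hp _)
    (sum_prod_weight hp1 n) _) n.cast_nonneg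

end Words

/-! ### Monotonicity along the linear system -/

section Telescoping

open Matrix Polynomial

variable {m : ℕ} {ι : Type*}

/-- The points `∑ⱼ u (a j) b (j - k)`, indexed by the words `a` of length `n`. -/
def wordPoint (u : Fin m → ℂ) (b : ℤ → ι → ℂ) (n k : ℕ) (a : Fin n → Fin m) : ι → ℂ :=
  ∑ j : Fin n, u (a j) • b ((j : ℤ) - k)

/-- The weight of a word: the probability that independent letters spell it, which is the
product of the weights of its letters. -/
def wordWeight (p : Fin m → ℝ) (n : ℕ) (a : Fin n → Fin m) : ENNReal :=
  ENNReal.ofReal (∏ j, p (a j))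

/-- The chain rule for a word which is split into its letter number `k` and the other letters: given
the other letters, the observation of the letter is a translate of `u i c + G`, and the translation
does not matter. -/
lemma condEntropy_wordPoint_split [Fintype ι] {p : Fin m → ℝ} (hp : ∀ j, 0 ≤ p j)
    (hp1 : ∑ j, p j = 1) (u : Fin m → ℂ) (n : ℕ) (k : Fin (n + 1))
    (x : (Fin (n + 1) → Fin m) → ι → ℂ) (c : ι → ℂ) (z : (Fin n → Fin m) → ι → ℂ)
    (hx : ∀ i a, x (k.insertNth i a) = z a + u i • c) :
    condEntropy (gaussianTranslates (wordWeight p (n + 1)) x)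
      = condEntropy (fun a => ∑ i, gaussianTranslates
          (fun q : Fin m × (Fin n → Fin m) => wordWeight p (n + 1) (k.insertNth q.1 q.2))
          (fun q => x (k.insertNth q.1 q.2)) (i, a))
        + condEntropy (gaussianTranslates (fun i => ENNReal.ofReal (p i)) fun i => u i • c) := by
  have hfin : ∀ q : Fin m × (Fin n → Fin m), IsFiniteMeasure
      (gaussianTranslates (wordWeight p (n + 1)) x (Fin.insertNthEquiv (fun _ => Fin m) k q)) :=
    fun q => isFiniteMeasure_gaussianTranslates (fun _ => ENNReal.ofReal_ne_top) _ _
  rw [← condEntropy_comp_equiv (Fin.insertNthEquiv (fun _ => Fin m) k), condEntropy_prod]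
  congr 1
  have e : ∀ a : Fin n → Fin m, condEntropy (fun i => gaussianTranslates (wordWeight p (n + 1)) x
      (Fin.insertNthEquiv (fun _ => Fin m) k (i, a)))
      = (∏ j, p (a j)) *
        condEntropy (gaussianTranslates (fun i => ENNReal.ofReal (p i)) fun i => u i • c) := by
    intro a
    have hfin' : ∀ i, IsFiniteMeasure
        (gaussianTranslates (fun i => ENNReal.ofReal (p i)) (fun i => z a + u i • c) i) :=
      isFiniteMeasure_gaussianTranslates (fun _ => ENNReal.ofReal_ne_top) _
    rw [← condEntropy_gaussianTranslates_add (fun _ => ENNReal.ofReal_ne_top) _ (z a),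
      ← ENNReal.toReal_ofReal (Finset.prod_nonneg fun j _ => hp (a j)),
      ← condEntropy_smul _ ENNReal.ofReal_ne_top]
    congr 1
    ext1 i
    unfold gaussianTranslates wordWeight
    simp only [Fin.insertNthEquiv_apply]
    have hxi : x (Fin.insertNthEquiv (fun _ => Fin m) k (i, a)) = z a + u i • c := hx i a
    rw [hxi, smul_smul, Fin.prod_univ_succAbove _ k, ← ENNReal.ofReal_mul
      (Finset.prod_nonneg fun j _ => hp (a j)), mul_comm]
    simp
  simp_rw [e]
  rw [← Finset.sum_mul, sum_prod_weight hp1, one_mul]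

lemma wordPoint_insertNth (u : Fin m → ℂ) (b : ℤ → ι → ℂ) (n : ℕ) (k : Fin (n + 1)) (l : ℕ)
    (i : Fin m) (a : Fin n → Fin m) : wordPoint u b (n + 1) l (k.insertNth i a)
      = (∑ j : Fin n, u (a j) • b ((k.succAbove j : ℕ) - (l : ℤ)))
        + u i • b ((k : ℕ) - (l : ℤ)) := by
  unfold wordPoint
  rw [Fin.sum_univ_succAbove _ k, add_comm]
  simp

/-- One step of the telescoping sum. Applying `A` moves the points by one step; the contribution
of the letter number `k` is singled out by the chain rule, and the remaining part increases by
the data processing inequality. -/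
lemma condEntropy_wordPoint_step [Fintype ι] [DecidableEq ι] {A : Matrix ι ι ℂ}
    {v : Matrix ι Unit ℂ} (hA : A * Aᴴ + v * vᴴ = 1) {b : ℤ → ι → ℂ}
    (hb : ∀ j, A *ᵥ b j = b (j + 1)) {p : Fin m → ℝ} (hp : ∀ j, 0 ≤ p j) (hp1 : ∑ j, p j = 1)
    (u : Fin m → ℂ) {n k : ℕ}
    (hk : k < n) :
    condEntropy (gaussianTranslates (fun i => ENNReal.ofReal (p i)) fun i => u i • b 0)
        - condEntropy (gaussianTranslates (fun i => ENNReal.ofReal (p i)) fun i => u i • b (-1))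
      ≤ condEntropy (gaussianTranslates (wordWeight p n) (wordPoint u b n k))
        - condEntropy (gaussianTranslates (wordWeight p n) (wordPoint u b n (k + 1))) := by
  obtain ⟨n, rfl⟩ : ∃ n', n = n' + 1 := ⟨n - 1, by omega⟩
  have e0 := condEntropy_wordPoint_split hp hp1 u n ⟨k, hk⟩ (wordPoint u b (n + 1) k) (b 0)
    (fun a => ∑ j : Fin n, u (a j) • b ((Fin.succAbove ⟨k, hk⟩ j : ℕ) - (k : ℤ)))
    fun i a => by rw [wordPoint_insertNth]; simp only [sub_self]
  have e1 := condEntropy_wordPoint_split hp hp1 u n ⟨k, hk⟩ (wordPoint u b (n + 1) (k + 1)) (b (-1))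
    (fun a => ∑ j : Fin n, u (a j) • b ((Fin.succAbove ⟨k, hk⟩ j : ℕ) - ((k + 1 : ℕ) : ℤ)))
    fun i a => by
      rw [wordPoint_insertNth]
      dsimp only
      rw [show ((k : ℕ) : ℤ) - ((k + 1 : ℕ) : ℤ) = -1 by push_cast; ring]
  have h := condEntropy_sum_gaussianTranslates_le hA
    (w := fun q : Fin m × (Fin n → Fin m) =>
      wordWeight p (n + 1) (Fin.insertNth (α := fun _ => Fin m) ⟨k, hk⟩ q.1 q.2))
    (fun _ => ENNReal.ofReal_ne_top)
    (fun q => wordPoint u b (n + 1) (k + 1) (Fin.insertNth (α := fun _ => Fin m) ⟨k, hk⟩ q.1 q.2))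
  have hAx : ∀ a, A *ᵥ wordPoint u b (n + 1) (k + 1) a = wordPoint u b (n + 1) k a := by
    intro a
    unfold wordPoint
    rw [mulVec_sum]
    refine Finset.sum_congr rfl fun j _ => ?_
    rw [mulVec_smul, hb]
    congr 2
    push_cast
    ring
  simp_rw [hAx] at h
  linarith

lemma mul_sub_le_condEntropy_wordPoint_sub [Fintype ι] [DecidableEq ι] {A : Matrix ι ι ℂ}
    {v : Matrix ι Unit ℂ} (hA : A * Aᴴ + v * vᴴ = 1) {b : ℤ → ι → ℂ}
    (hb : ∀ j, A *ᵥ b j = b (j + 1)) {p : Fin m → ℝ} (hp : ∀ j, 0 ≤ p j) (hp1 : ∑ j, p j = 1)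
    (u : Fin m → ℂ) (n : ℕ) :
    ∀ k ≤ n, k * (condEntropy (gaussianTranslates (fun i => ENNReal.ofReal (p i))
          fun i => u i • b 0)
        - condEntropy (gaussianTranslates (fun i => ENNReal.ofReal (p i)) fun i => u i • b (-1)))
      ≤ condEntropy (gaussianTranslates (wordWeight p n) (wordPoint u b n 0))
        - condEntropy (gaussianTranslates (wordWeight p n) (wordPoint u b n k)) := by
  intro k
  induction k with
  | zero => simp
  | succ k ih =>
    intro hk
    have h1 := ih (by omega)
    have h2 := condEntropy_wordPoint_step hA hb hp hp1 u (show k < n by omega)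
    push_cast
    linarith

/-- The conditional entropy is at most the entropy of the word for `k = 0`, and at least the entropy
of the word given the sum `∑ⱼ u (a j) ηʲ` for `k = n`. -/
lemma mul_sub_condEntropy_le_shannonEntropy [Fintype ι] [DecidableEq ι] {A : Matrix ι ι ℂ}
    {v : Matrix ι Unit ℂ} (hA : A * Aᴴ + v * vᴴ = 1) {b : ℤ → ι → ℂ}
    (hb : ∀ j, A *ᵥ b j = b (j + 1)) {p : Fin m → ℝ} (hp : ∀ j, 0 ≤ p j) (hp1 : ∑ j, p j = 1)
    (u : Fin m → ℂ) (η : ℂ) (n : ℕ)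
    (hη : ∀ a a' : Fin n → Fin m,
      ∑ j : Fin n, u (a j) * η ^ (j : ℕ) = ∑ j : Fin n, u (a' j) * η ^ (j : ℕ) →
      wordPoint u b n n a = wordPoint u b n n a') :
    n * (condEntropy (gaussianTranslates (fun i => ENNReal.ofReal (p i)) fun i => u i • b 0)
        - condEntropy (gaussianTranslates (fun i => ENNReal.ofReal (p i)) fun i => u i • b (-1)))
      ≤ shannonEntropy (garsiaLaw η (atomicMeasure p u) n) := by
  have hq : ∀ a : Fin n → Fin m, 0 ≤ ∏ j, p (a j) := fun a => Finset.prod_nonneg fun _ _ => hp _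
  have h1 := mul_sub_le_condEntropy_wordPoint_sub hA hb hp hp1 u n n le_rfl
  have hprob : ∀ a, IsProbabilityMeasure
      ((gaussianPi ι).map fun y => wordPoint u b n n a + y) :=
    fun a => Measure.isProbabilityMeasure_map (by fun_prop)
  have h2 := sum_negMulLog_sub_atomicEntropy_le_condEntropy hq
    (fun a : Fin n → Fin m => ∑ j : Fin n, u (a j) * η ^ (j : ℕ))
    (fun a => (gaussianPi ι).map fun y => wordPoint u b n n a + y)
    (fun a a' h => by rw [hη a a' h])
  have hfin := isFiniteMeasure_gaussianTranslates (w := wordWeight p n)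
    (fun _ => ENNReal.ofReal_ne_top) (wordPoint u b n 0)
  have hmass : ∀ a, (gaussianTranslates (wordWeight p n) (wordPoint u b n 0) a).real Set.univ
      = ∏ j, p (a j) := by
    intro a
    have : IsProbabilityMeasure ((gaussianPi ι).map fun y => wordPoint u b n 0 a + y) :=
      Measure.isProbabilityMeasure_map (by fun_prop)
    rw [gaussianTranslates, measureReal_ennreal_smul_apply, probReal_univ, wordWeight,
      ENNReal.toReal_ofReal (hq a), mul_one]
  have h3 := condEntropy_le_sum_negMulLog (gaussianTranslates (wordWeight p n) (wordPoint u b n 0))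
    (by simp_rw [hmass]; exact sum_prod_weight hp1 n)
  simp_rw [hmass] at h3
  rw [shannonEntropy_garsiaLaw η hp]
  change _ ≤ condEntropy (gaussianTranslates (wordWeight p n) (wordPoint u b n n)) at h2
  linarith

end Telescoping

/-! ### Coincidences of sums and conjugates -/

section Algebraic

open Matrix Polynomial

variable {m : ℕ} {ι : Type*} [Fintype ι] [DecidableEq ι]

lemma aeval_eq_zero_of_charpoly_dvd {K : Subfield ℂ} {η : ℂ} {A : Matrix ι ι ℂ}
    (hA : A.charpoly ∣ (minpoly K η).map (algebraMap K ℂ)) {f : K[X]} (hf : aeval η f = 0) :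
    aeval A (f.map (algebraMap K ℂ)) = 0 := by
  obtain ⟨g, hg⟩ := hA.trans (Polynomial.map_dvd (algebraMap K ℂ) (minpoly.dvd K η hf))
  rw [hg, map_mul, aeval_self_charpoly, zero_mul]

/-- Coincidences between the sums `∑ⱼ u (a j) ηʲ` carry over to every matrix whose eigenvalues are
conjugates of `η`. -/
lemma sum_smul_pow_eq {K : Subfield ℂ} {η : ℂ} {A : Matrix ι ι ℂ}
    (hA : A.charpoly ∣ (minpoly K η).map (algebraMap K ℂ)) {u : Fin m → ℂ} (hu : ∀ j, u j ∈ K)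
    {n : ℕ} {a a' : Fin n → Fin m}
    (h : ∑ j : Fin n, u (a j) * η ^ (j : ℕ) = ∑ j : Fin n, u (a' j) * η ^ (j : ℕ)) :
    ∑ j : Fin n, u (a j) • A ^ (j : ℕ) = ∑ j : Fin n, u (a' j) • A ^ (j : ℕ) := by
  let f : (Fin n → Fin m) → K[X] := fun a => ∑ j : Fin n, C (⟨u (a j), hu _⟩ : K) * X ^ (j : ℕ)
  have h1 : ∀ a, aeval η (f a) = ∑ j : Fin n, u (a j) * η ^ (j : ℕ) := by
    intro a
    simp only [f, map_sum, map_mul, aeval_C, map_pow, aeval_X]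
    rfl
  have h2 : ∀ a, aeval A ((f a).map (algebraMap K ℂ)) = ∑ j : Fin n, u (a j) • A ^ (j : ℕ) := by
    intro a
    simp only [f, Polynomial.map_sum, Polynomial.map_mul, Polynomial.map_C, Polynomial.map_pow,
      Polynomial.map_X, map_sum, map_mul, aeval_C, map_pow, aeval_X, Algebra.smul_def]
    rfl
  have h3 := aeval_eq_zero_of_charpoly_dvd hA (f := f a - f a') (by
    rw [map_sub, h1, h1, h, sub_self])
  rw [Polynomial.map_sub, map_sub, h2, h2] at h3
  exact sub_eq_zero.1 h3

lemma wordPoint_eq_of_sum_eq {K : Subfield ℂ} {η : ℂ} {A : Matrix ι ι ℂ} (hdet : IsUnit A.det)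
    (hA : A.charpoly ∣ (minpoly K η).map (algebraMap K ℂ)) {u : Fin m → ℂ} (hu : ∀ j, u j ∈ K)
    (x : ι → ℂ) {n : ℕ} {a a' : Fin n → Fin m}
    (h : ∑ j : Fin n, u (a j) * η ^ (j : ℕ) = ∑ j : Fin n, u (a' j) * η ^ (j : ℕ)) :
    wordPoint u (fun j : ℤ => (A ^ j) *ᵥ x) n n a
      = wordPoint u (fun j : ℤ => (A ^ j) *ᵥ x) n n a' := by
  have e : ∀ a : Fin n → Fin m, wordPoint u (fun j : ℤ => (A ^ j) *ᵥ x) n n a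
      = (A ^ (-(n : ℤ))) *ᵥ ((∑ j : Fin n, u (a j) • A ^ (j : ℕ)) *ᵥ x) := by
    intro a
    unfold wordPoint
    rw [sum_mulVec, mulVec_sum]
    refine Finset.sum_congr rfl fun j _ => ?_
    rw [smul_mulVec, mulVec_smul, mulVec_mulVec, ← zpow_natCast A j,
      ← Matrix.zpow_add hdet, neg_add_eq_sub]
  rw [e, e, sum_smul_pow_eq hA hu h]

end Algebraic

/-! ### Comparison of the entropies -/

section Conclusion

open Matrix Polynomial

variable {m : ℕ}

lemma sum_norm_sq_eq_of_conjTranspose_mul {ι : Type*} [Fintype ι] {v : Matrix ι Unit ℂ} {D : ℂ}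
    (h : vᴴ * v + (D * star D) • 1 = 1) : ∑ i, ‖v i ()‖ ^ 2 = 1 - ‖D‖ ^ 2 := by
  have h1 := congrFun (congrFun h ()) ()
  simp only [Matrix.add_apply, mul_apply, conjTranspose_apply, Matrix.smul_apply, one_apply_eq,
    Complex.star_def, Complex.mul_conj, smul_eq_mul, mul_one, Complex.normSq_eq_norm_sq,
    mul_comm ((starRingEnd ℂ) _)] at h1
  have h2 : ((∑ i, ‖v i ()‖ ^ 2 : ℝ) : ℂ) = ((1 - ‖D‖ ^ 2 : ℝ) : ℂ) := by
    push_cast at h1 ⊢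
    linear_combination h1
  exact_mod_cast h2

/-- The bound for a fixed `n` and a fixed scale `t`. If `[A, v; w, D]` is unitary, then `v` has norm
`√(1 - |D|²)` and its preimage under `A` has this norm divided by `|D|`. -/
lemma mul_differentialEntropy_sub_le_shannonEntropy {K : Subfield ℂ} {η : ℂ} {u : Fin m → ℂ}
    (hu : ∀ j, u j ∈ K) {p : Fin m → ℝ} (hp : ∀ j, 0 ≤ p j) (hp1 : ∑ j, p j = 1)
    {s : Finset ℂ} (hs0 : ∀ β ∈ s, β ≠ 0) (hs1 : ∀ β ∈ s, ‖β‖ < 1) (hs : s.Nonempty)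
    (hdvd : ∏ β ∈ s, (X - C β) ∣ (minpoly K η).map (algebraMap K ℂ)) {t : ℝ} (ht : 0 < t) (n : ℕ) :
    n * (differentialEntropy (smoothedLaw (atomicMeasure p u) (t * ∏ β ∈ s, ‖β‖⁻¹))
        - differentialEntropy (smoothedLaw (atomicMeasure p u) t))
      ≤ shannonEntropy (garsiaLaw η (atomicMeasure p u) n) := by
  obtain ⟨ι, _, _, A, v, w, D, h1, h2, h3, h4, h5, h6, h7⟩ :=
    exists_unitary_blocks s.val fun β hβ => (hs1 β hβ).le
  have hD : ‖D‖ = ∏ β ∈ s, ‖β‖ := h7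
  have hdet : IsUnit A.det := by
    rw [h6, isUnit_iff_ne_zero]
    exact Multiset.prod_ne_zero fun h0 => hs0 0 h0 rfl
  have hD0 : 0 < ‖D‖ := by
    rw [hD]
    exact Finset.prod_pos fun β hβ => norm_pos_iff.2 (hs0 β hβ)
  have hD1 : ‖D‖ < 1 := by
    obtain ⟨β, hβ⟩ := hs
    rw [hD, ← Finset.mul_prod_erase s _ hβ]
    exact mul_lt_one_of_nonneg_of_lt_one_left (norm_nonneg _) (hs1 β hβ)
      (Finset.prod_le_one (fun _ _ => norm_nonneg _)
        fun b hb => (hs1 b (Finset.mem_of_mem_erase hb)).le)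
  have hDne : star D ≠ 0 := star_ne_zero.2 (norm_pos_iff.1 hD0)
  obtain ⟨r, hr, hr2⟩ : ∃ r : ℝ, 0 < r ∧ r ^ 2 = 1 - ‖D‖ ^ 2 :=
    ⟨Real.sqrt (1 - ‖D‖ ^ 2), Real.sqrt_pos.2 (by nlinarith), Real.sq_sqrt (by nlinarith)⟩
  have hv : ∑ i, ‖v i ()‖ ^ 2 = r ^ 2 := by
    rw [hr2, sum_norm_sq_eq_of_conjTranspose_mul h4]
  have hw : ∑ i, ‖wᴴ i ()‖ ^ 2 = r ^ 2 := by
    rw [hr2, sum_norm_sq_eq_of_conjTranspose_mul (v := wᴴ) (by rwa [conjTranspose_conjTranspose])]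
  -- The points are scaled so that the first vector of the orbit has norm `t`.
  set x : ι → ℂ := fun i => (t / r : ℝ) * v i () with hx
  set b : ℤ → ι → ℂ := fun j => (A ^ j) *ᵥ x with hbdef
  have hb : ∀ j, A *ᵥ b j = b (j + 1) := by
    intro j
    rw [hbdef]
    dsimp only
    rw [mulVec_mulVec, add_comm, Matrix.zpow_add hdet, zpow_one]
  have hb0 : b 0 = x := by simp [hbdef]
  -- The relation `A w* = - D* v` gives the preimage of `v` under `A`.
  have hb1 : b (-1) = fun i => (-(t / r : ℝ) * (star D)⁻¹) * wᴴ i () := by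
    have e : A *ᵥ (fun i => (-(t / r : ℝ) * (star D)⁻¹) * wᴴ i ()) = x := by
      ext i
      have h2i := congrFun (congrFun h2 i) ()
      simp only [Matrix.add_apply, mul_apply, Matrix.smul_apply, smul_eq_mul,
        Matrix.zero_apply] at h2i
      simp only [mulVec, dotProduct, hx, mul_left_comm (A i _)]
      rw [← Finset.mul_sum, eq_neg_of_add_eq_zero_left h2i]
      field_simp
    rw [hbdef]
    dsimp only
    rw [← e, mulVec_mulVec, Matrix.zpow_neg_one, nonsing_inv_mul _ hdet, one_mulVec]
  have key := mul_sub_condEntropy_le_shannonEntropy h1 hb hp hp1 u η n fun a a' h =>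
    wordPoint_eq_of_sum_eq hdet (by rw [h5]; exact hdvd) hu x h
  have htop : ∀ k, ENNReal.ofReal (p k) ≠ ⊤ := fun _ => ENNReal.ofReal_ne_top
  have hn0 : ∑ i, ‖b 0 i‖ ^ 2 = t ^ 2 := by
    rw [hb0, hx]
    simp only [norm_mul, mul_pow, Complex.norm_real, Real.norm_eq_abs, sq_abs]
    rw [← Finset.mul_sum, hv]
    field_simp
  have hn1 : ∑ i, ‖b (-1) i‖ ^ 2 = (t * ∏ β ∈ s, ‖β‖⁻¹) ^ 2 := by
    rw [hb1, Finset.prod_inv_distrib, ← hD]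
    simp only [norm_mul, mul_pow, norm_neg, norm_inv, norm_star, Complex.norm_real,
      Real.norm_eq_abs, sq_abs]
    rw [← Finset.mul_sum, hw]
    field_simp
  have htM : 0 < t * ∏ β ∈ s, ‖β‖⁻¹ :=
    mul_pos ht (Finset.prod_pos fun β hβ => inv_pos.2 (norm_pos_iff.2 (hs0 β hβ)))
  -- Both conditional entropies are reduced to the complex plane, where they differ from the
  -- differential entropies by the same constant and by the sign.
  rw [condEntropy_gaussianTranslates_smul htop u _ ht hn0,
    condEntropy_gaussianTranslates_smul htop u _ htM hn1,
    condEntropy_gaussianTranslates_unit htop, condEntropy_gaussianTranslates_unit htop] at key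
  have d0 := differentialEntropy_smoothedLaw_add_condEntropy hp u t
  have d1 := differentialEntropy_smoothedLaw_add_condEntropy hp u (t * ∏ β ∈ s, ‖β‖⁻¹)
  refine le_trans (le_of_eq ?_) key
  congr 1
  linarith

/-- Only the conjugates inside the unit disc contribute to `mahlerTilde`. -/
lemma mahlerTilde_eq_prod_inv (K : Subfield ℂ) (η : ℂ) :
    mahlerTilde K η = ∏ β ∈ ((minpoly K η).rootSet ℂ).toFinset with ‖β‖ < 1, ‖β‖⁻¹ := by
  rw [mahlerTilde, Finset.prod_filter]
  refine Finset.prod_congr rfl fun β _ => ?_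
  split_ifs with h
  · rw [min_eq_right h.le, one_div]
  · rw [min_eq_left (not_lt.1 h), one_div_one]

end Conclusion

end

theorem proposition6p2 (K : Subfield ℂ) (η : ℂ) (hη0 : 0 < ‖η‖) (hη1 : ‖η‖ < 1)
    (hfin : FiniteDimensional K (IntermediateField.adjoin K {η}))
    (m : ℕ) (u : Fin m → ℂ) (hu : ∀ j, u j ∈ K)
    (p : Fin m → ℝ) (hp : ∀ j, 0 ≤ p j) (hp1 : ∑ j, p j = 1) :
    Tendsto (fun n : ℕ => shannonEntropy (garsiaLaw η (atomicMeasure p u) n) / n) atTop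
        (𝓝 (garsiaEntropy η (atomicMeasure p u))) ∧
      (∀ c : ℝ, HasDifferentialEntropy (smoothedLaw (atomicMeasure p u) c)) ∧
      gaussianGain (atomicMeasure p u) (mahlerTilde K η)
        ≤ (garsiaEntropy η (atomicMeasure p u) : EReal) := by
  refine ⟨tendsto_garsiaEntropy η hp hp1 u, hasDifferentialEntropy_smoothedLaw hp u,
    iSup_le fun ⟨t, ht⟩ => EReal.coe_le_coe_iff.2 ?_⟩
  have hint : IsIntegral K η :=
    (IsIntegral.of_finite K (IntermediateField.AdjoinSimple.gen K η)).map
      (IntermediateField.adjoin K {η}).val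
  have hη : η ≠ 0 := norm_pos_iff.1 hη0
  have hne : minpoly K η ≠ 0 := minpoly.ne_zero hint
  have hmap : (minpoly K η).map (algebraMap K ℂ) ≠ 0 :=
    (Polynomial.map_ne_zero_iff (algebraMap K ℂ).injective).2 hne
  have hroot : ∀ β : ℂ, β ∈ ((minpoly K η).rootSet ℂ).toFinset ↔
      Polynomial.aeval β (minpoly K η) = 0 := by
    intro β
    rw [Set.mem_toFinset, Polynomial.mem_rootSet_of_ne hne]
  rw [mahlerTilde_eq_prod_inv]
  set s := {β ∈ ((minpoly K η).rootSet ℂ).toFinset | ‖β‖ < 1} with hs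
  have hs0 : ∀ β ∈ s, β ≠ 0 := by
    rintro β hβ rfl
    have h0 := (hroot 0).1 (Finset.mem_filter.1 hβ).1
    rw [← Polynomial.coeff_zero_eq_aeval_zero'] at h0
    exact minpoly.coeff_zero_ne_zero hint hη ((map_eq_zero _).1 h0)
  have hsη : η ∈ s := Finset.mem_filter.2 ⟨(hroot η).2 (minpoly.aeval K η), hη1⟩
  have hdvd : ∏ β ∈ s, (Polynomial.X - Polynomial.C β)
      ∣ (minpoly K η).map (algebraMap K ℂ) := by
    refine (Multiset.prod_X_sub_C_dvd_iff_le_roots hmap s.val).2 ?_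
    rw [Multiset.le_iff_subset s.nodup]
    intro β hβ
    rw [Polynomial.mem_roots hmap, Polynomial.IsRoot, Polynomial.eval_map_algebraMap]
    exact (hroot β).1 (Finset.mem_filter.1 hβ).1
  refine ge_of_tendsto (tendsto_garsiaEntropy η hp hp1 u) ?_
  filter_upwards [eventually_gt_atTop 0] with n hn
  rw [le_div_iff₀ (by exact_mod_cast hn), mul_comm]
  exact mul_differentialEntropy_sub_le_shannonEntropy hu hp hp1 hs0
    (fun β hβ => (Finset.mem_filter.1 hβ).2) ⟨η, hsη⟩ hdvd ht n
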